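/- Let $n\ge 0$ and let $\mu$ be a probability measure on $\mathbb{R}^n$ with a differentiable density $f:\mathbb{R}^n\to[0,\infty)$ with respect to the Lebesgue measure $\lambda_n$, and let $\gamma_n$ be the standard Gaussian measure. For a measure $\nu\ll\lambda_n$ let $\mathsf{H}(\nu\|\lambda_n)=\int\log\big(\tfrac{d\nu}{d\lambda_n}\big)\,d\nu\in[-\infty,\infty]$, and assume that $\mathsf{H}(\mu\|\lambda_n)$ is well defined, i.e. that the positive and the negative part of $\log f$ do not both have infinite $\mu$-integral. Let $\mathrm{Diff}(\mathbb{R}^n)$ be the set of $C^\infty$ diffeomorphisms of $\mathbb{R}^n$ and, for $T\in\mathrm{Diff}(\mathbb{R}^n)$ with differential $\mathsf{D}T$, put $$\psi(T)=\frac12\left(\int_{\mathbb{R}^n}\left|\frac{\mathsf{D}T(T^{-1}(x))^{\top}\nabla f(x)}{f(x)}+\big(\nabla\log|\det\mathsf{D}T|\big)(T^{-1}(x))\right|^2d\mu(x)-n\right)-\int_{\mathbb{R}^n}\log|\det\mathsf{D}T(T^{-1}(x))|\,d\mu(x)\in[-\infty,\infty],$$ with the convention that $\psi(T)=+\infty$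 if the first integral is infinite or the second one is undefined (both its positive and its negative part have infinite integral). Then: 1. for every $T\in\mathrm{Diff}(\mathbb{R}^n)$, $\ \mathsf{H}(\mu\|\lambda_n)-\mathsf{H}(\gamma_n\|\lambda_n)\le\psi(T)$; 2. equality holds in 1 whenever $T^{-1}$ transports $\mu$ to $\gamma_n$, i.e. $(T^{-1})_{\#}\mu=\gamma_n$; 3. if $f$ is moreover $C^\infty$ and strictly positive, then there is $T\in\mathrm{Diff}(\mathbb{R}^n)$ with $(T^{-1})_{\#}\mu=\gamma_n$, and $$\mathsf{H}(\mu\|\lambda_n)-\mathsf{H}(\gamma_n\|\lambda_n)=\min_{T\in\mathrm{Diff}(\mathbb{R}^n)}\psi(T).$$ -/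

import Mathlib

open MeasureTheory ProbabilityTheory
open scoped ContDiff

/-- Smooth diffeomorphisms of `ℝⁿ`. -/
abbrev SmoothDiffeo (n : ℕ) : Type :=
  Diffeomorph (modelWithCornersSelf ℝ (EuclideanSpace ℝ (Fin n)))
    (modelWithCornersSelf ℝ (EuclideanSpace ℝ (Fin n)))
    (EuclideanSpace ℝ (Fin n)) (EuclideanSpace ℝ (Fin n)) ∞

/-- The integral of a real function is defined as an element of `[-∞, ∞]`: its positive part and
its negative part do not both have infinite integral. -/
def QuasiIntegrable {α : Type*} [MeasurableSpace α] (g : α → ℝ) (μ : Measure α) : Prop :=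
  ∫⁻ x, ENNReal.ofReal (g x) ∂μ ≠ ⊤ ∨ ∫⁻ x, ENNReal.ofReal (-g x) ∂μ ≠ ⊤

/-- The integral of a real function with values in `[-∞, ∞]`: integral of the positive part minus
integral of the negative part. It is only meaningful for quasi-integrable functions. -/
noncomputable def extIntegral {α : Type*} [MeasurableSpace α] (g : α → ℝ) (μ : Measure α) :
    EReal :=
  ((∫⁻ x, ENNReal.ofReal (g x) ∂μ : ENNReal) : EReal) -
    ((∫⁻ x, ENNReal.ofReal (-g x) ∂μ : ENNReal) : EReal)

/-- The relative entropy `H(μ ‖ ν) = ∫ log (dμ/dν) dμ`, with values in `[-∞, ∞]`. -/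
noncomputable def relEntropy {α : Type*} [MeasurableSpace α] (μ ν : Measure α) : EReal :=
  extIntegral (llr μ ν) μ

/-- The function `log |det DT|`. -/
noncomputable def logAbsDet {n : ℕ} (T : SmoothDiffeo n) (x : EuclideanSpace ℝ (Fin n)) : ℝ :=
  Real.log |(fderiv ℝ T x).det|

/-- The vector field `DT(T⁻¹ x)ᵀ ∇f(x) / f(x) + (∇ log |det DT|)(T⁻¹ x)`. -/
noncomputable def scoreField {n : ℕ} (f : EuclideanSpace ℝ (Fin n) → ℝ) (T : SmoothDiffeo n)
    (x : EuclideanSpace ℝ (Fin n)) : EuclideanSpace ℝ (Fin n) :=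
  (f x)⁻¹ • (ContinuousLinearMap.adjoint (fderiv ℝ T (T.symm x))) (gradient f x) +
    gradient (logAbsDet T) (T.symm x)

/-- The integral `∫ |DT(T⁻¹ x)ᵀ ∇f(x) / f(x) + (∇ log |det DT|)(T⁻¹ x)|² dμ(x)` in `[0, ∞]`. -/
noncomputable def scoreEnergy {n : ℕ} (μ : Measure (EuclideanSpace ℝ (Fin n)))
    (f : EuclideanSpace ℝ (Fin n) → ℝ) (T : SmoothDiffeo n) : ENNReal :=
  ∫⁻ x, ENNReal.ofReal (‖scoreField f T x‖ ^ 2) ∂μ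

open Classical in
/-- The functional
`ψ(T) = (∫ |DT(T⁻¹ x)ᵀ ∇f(x) / f(x) + (∇ log |det DT|)(T⁻¹ x)|² dμ(x) - n) / 2
  - ∫ log |det DT(T⁻¹ x)| dμ(x)`
for the measure `μ` with density `f`. It is `+∞` when the first integral is infinite or the second
one is undefined. -/
noncomputable def psiFunctional {n : ℕ} (μ : Measure (EuclideanSpace ℝ (Fin n)))
    (f : EuclideanSpace ℝ (Fin n) → ℝ) (T : SmoothDiffeo n) : EReal :=
  if scoreEnergy μ f T = ⊤ ∨ ¬ QuasiIntegrable (fun x => logAbsDet T (T.symm x)) μ then ⊤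
  else ((((scoreEnergy μ f T).toReal - n) / 2 : ℝ) : EReal) -
    extIntegral (fun x => logAbsDet T (T.symm x)) μ

/-! ### The Gaussian quantile function and the probability integral transform. -/

section GaussianQuantile

open Filter Topology Set

/-! Let `g = pullbackDensity f T` be the density of the image of `μ` under `T⁻¹`. Where `g ≠ 0`,
`∇g(y) = g(y) • scoreField f T (T y)`, so the first integral in `ψ(T)` is the Fisher information
`I(g) = ∫ |∇g|² / g`; moreover `log f(x) = log g(T⁻¹x) - log |det DT(T⁻¹x)|`. Part 1 thus reduces to
the Euclidean logarithmic Sobolev inequality `∫ g log g ≤ I(g)/2 - n (log(2π)/2 + 1)`, which is an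
equality for the Gaussian density; a direct computation with that density gives part 2.

The inequality (`exists_log_density_bound`) is proved one coordinate at a time by transport. On the
line, let `S` be the increasing map from a density `q` to the Gaussian density `φ`. Formally `S' = q
/ φ(S)`, hence `log q = log S' + log φ(S) ≤ S' - 1 - S²/2 - log(2π)/2`, while `∫ q S' = -∫ q' S ≤ (∫
q'²/q + ∫ S² q)/2` and `∫ S² q = 1`. The map `S` is only used as a monotone function: Tonelli's
theorem replaces the integration by parts (`lintegral_density_div_gaussianPDF_transport_le`). In
higher dimension a log-density is the sum of a conditional and a marginal one, and coordinates
already treated are moved into a parameter space, so that no marginal has to be differentiated. All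
bounds are pointwise bounds by integrable functions, which leaves room for infinite entropies.

For part 3 an induction on the dimension shows that any two probability measures with smooth
positive densities are related by a smooth diffeomorphism (`hasSmoothTransport_addHaar`). On `E ×
ℝ`, a shear `(z, t) ↦ (a(t)⁻¹ z, t)` makes all `z`-derivatives of the density integrable in `t`; the
marginal on `E` is then smooth, and the logit of the conditional distribution function straightens
the measure into a product of this marginal and the logistic law (`exists_smoothlyEquivalent_prod`).
Parts 1 and 2 turn the existence of such a `T` into attainment of the minimum. -/

theorem continuous_cdf_of_noAtoms (q : Measure ℝ) [IsProbabilityMeasure q]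
    (hq : ∀ t, q {t} = 0) : Continuous (cdf q) := by
  refine continuous_iff_continuousAt.2 fun t => ?_
  rw [(cdf q).mono.continuousAt_iff_leftLim_eq_rightLim, (cdf q).rightLim_eq]
  have h := (cdf q).measure_singleton t
  rw [measure_cdf, hq t] at h
  have h1 := ENNReal.ofReal_eq_zero.1 h.symm
  exact le_antisymm ((cdf q).mono.leftLim_le le_rfl) (by linarith)

theorem exists_cdf_eq (q : Measure ℝ) [IsProbabilityMeasure q] (hq : ∀ t, q {t} = 0) {u : ℝ}
    (hu : u ∈ Ioo (0 : ℝ) 1) : ∃ c, cdf q c = u := by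
  have hc := continuous_cdf_of_noAtoms q hq
  obtain ⟨a, ha⟩ := ((tendsto_cdf_atBot q).eventually (gt_mem_nhds hu.1)).exists
  obtain ⟨b, hb⟩ := ((tendsto_cdf_atTop q).eventually (lt_mem_nhds hu.2)).exists
  exact mem_range_of_exists_le_of_exists_ge hc ⟨a, ha.le⟩ ⟨b, hb.le⟩

/-- The sublevel set of the continuous monotone `cdf q` is a closed half-line whose endpoint attains
the value `u`. The supremum is needed because `cdf q` may have flat pieces. -/
theorem measure_cdf_le (q : Measure ℝ) [IsProbabilityMeasure q] (hq : ∀ t, q {t} = 0) {u : ℝ}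
    (hu : u ∈ Ioo (0 : ℝ) 1) : q {t | cdf q t ≤ u} = ENNReal.ofReal u := by
  have hc := continuous_cdf_of_noAtoms q hq
  set S := {t | cdf q t ≤ u} with hS
  have hne : S.Nonempty := by
    obtain ⟨c, hc⟩ := exists_cdf_eq q hq hu
    exact ⟨c, hc.le⟩
  have hbd : BddAbove S := by
    obtain ⟨b, hb⟩ := ((tendsto_cdf_atTop q).eventually (lt_mem_nhds hu.2)).exists
    refine ⟨b, fun t ht => le_of_not_gt fun hbt => ?_⟩
    exact absurd (hb.trans_le ((cdf q).mono hbt.le)) (not_lt.2 ht)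
  have hcl : IsClosed S := isClosed_le hc continuous_const
  have hmem : sSup S ∈ S := hcl.csSup_mem hne hbd
  have hSI : S = Iic (sSup S) := by
    ext t
    exact ⟨fun ht => le_csSup hbd ht, fun ht => ((cdf q).mono ht).trans hmem⟩
  have hval : cdf q (sSup S) = u := by
    obtain ⟨c, hc⟩ := exists_cdf_eq q hq hu
    refine le_antisymm hmem ?_
    rw [← hc]
    exact (cdf q).mono (le_csSup hbd hc.le)
  rw [hSI, ← ofReal_cdf, hval]

theorem gaussianReal_singleton (t : ℝ) : gaussianReal 0 1 {t} = 0 := by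
  have := gaussianReal_absolutelyContinuous 0 (v := 1) one_ne_zero
  exact this (by simp)

theorem strictMono_cdf_gaussianReal : StrictMono (cdf (gaussianReal 0 1)) := by
  intro a b hab
  have h1 : cdf (gaussianReal 0 1) a ≤ cdf (gaussianReal 0 1) b := (cdf _).mono hab.le
  refine lt_of_le_of_ne h1 fun h => ?_
  have h2 := (cdf (gaussianReal 0 1)).measure_Ioc a b
  rw [measure_cdf, h, sub_self, ENNReal.ofReal_zero] at h2
  have h3 := gaussianReal_absolutelyContinuous' 0 (v := 1) one_ne_zero h2
  rw [Real.volume_Ioc, ENNReal.ofReal_eq_zero] at h3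
  linarith

/-- A measurable quantile function of the standard Gaussian measure. -/
theorem exists_gaussianQuantile : ∃ Q : ℝ → ℝ, Measurable Q ∧
    ∀ u ∈ Ioo (0 : ℝ) 1, ∀ a, Q u ≤ a ↔ u ≤ cdf (gaussianReal 0 1) a := by
  have hc := continuous_cdf_of_noAtoms (gaussianReal 0 1) gaussianReal_singleton
  have hemb : MeasurableEmbedding (cdf (gaussianReal 0 1)) :=
    hc.measurableEmbedding strictMono_cdf_gaussianReal.injective
  obtain ⟨Q, hQm, hQ⟩ := hemb.exists_measurable_extend measurable_id fun _ => inferInstance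
  refine ⟨Q, hQm, fun u hu a => ?_⟩
  obtain ⟨c, rfl⟩ := exists_cdf_eq (gaussianReal 0 1) gaussianReal_singleton hu
  have : Q (cdf (gaussianReal 0 1) c) = c := congrFun hQ c
  rw [this, strictMono_cdf_gaussianReal.le_iff_le]

/-- A chosen quantile function of the standard Gaussian measure. -/
noncomputable def gaussianQuantile : ℝ → ℝ := exists_gaussianQuantile.choose

theorem measurable_gaussianQuantile : Measurable gaussianQuantile :=
  exists_gaussianQuantile.choose_spec.1

theorem gaussianQuantile_le_iff {u : ℝ} (hu : u ∈ Ioo (0 : ℝ) 1) (a : ℝ) :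
    gaussianQuantile u ≤ a ↔ u ≤ cdf (gaussianReal 0 1) a :=
  exists_gaussianQuantile.choose_spec.2 u hu a

theorem gaussianQuantile_mono {u v : ℝ} (hu : u ∈ Ioo (0 : ℝ) 1) (hv : v ∈ Ioo (0 : ℝ) 1)
    (h : u ≤ v) : gaussianQuantile u ≤ gaussianQuantile v := by
  rw [gaussianQuantile_le_iff hu]
  exact h.trans ((gaussianQuantile_le_iff hv _).1 le_rfl)

theorem cdf_gaussianReal_mem_Ioo (a : ℝ) : cdf (gaussianReal 0 1) a ∈ Ioo (0 : ℝ) 1 :=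
  ⟨(cdf_nonneg _ (a - 1)).trans_lt (strictMono_cdf_gaussianReal (by linarith)),
    (strictMono_cdf_gaussianReal (show a < a + 1 by linarith)).trans_le (cdf_le_one _ _)⟩

theorem ae_cdf_mem_Ioo (q : Measure ℝ) [IsProbabilityMeasure q] (hq : ∀ t, q {t} = 0) :
    ∀ᵐ t ∂q, cdf q t ∈ Ioo (0 : ℝ) 1 := by
  have hm : Measurable (cdf q) := (cdf q).mono.measurable
  have hex : ∀ ε : ENNReal, 0 < ε → ∃ δ : ℝ, 0 < δ ∧ δ < 1 ∧ ENNReal.ofReal δ < ε := by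
    intro ε hε
    have : Tendsto (fun δ : ℝ => ENNReal.ofReal δ) (𝓝[>] 0) (𝓝 0) := by
      have := (ENNReal.continuous_ofReal.tendsto 0).mono_left
        (nhdsWithin_le_nhds (s := Ioi (0 : ℝ)))
      simpa using this
    obtain ⟨δ, h1, h2⟩ := ((this.eventually (gt_mem_nhds hε)).and
      (Ioo_mem_nhdsGT (show (0 : ℝ) < 1 by norm_num))).exists
    exact ⟨δ, h2.1, h2.2, h1⟩
  have h0 : q {t | cdf q t ≤ 0} = 0 := by
    refine le_antisymm (le_of_forall_gt fun ε hε => ?_) zero_le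
    obtain ⟨δ, hδ0, hδ1, hδ⟩ := hex ε hε
    calc q {t | cdf q t ≤ 0} ≤ q {t | cdf q t ≤ δ} :=
          measure_mono fun t (ht : cdf q t ≤ 0) => ht.trans hδ0.le
      _ = ENNReal.ofReal δ := measure_cdf_le q hq ⟨hδ0, hδ1⟩
      _ < ε := hδ
  have h1 : q {t | 1 ≤ cdf q t} = 0 := by
    refine le_antisymm (le_of_forall_gt fun ε hε => ?_) zero_le
    obtain ⟨δ, hδ0, hδ1, hδ⟩ := hex ε hε
    have hm' : MeasurableSet {t | cdf q t ≤ 1 - δ} := measurableSet_le hm measurable_const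
    calc q {t | 1 ≤ cdf q t} ≤ q {t | cdf q t ≤ 1 - δ}ᶜ :=
          measure_mono fun t (ht : 1 ≤ cdf q t) => by
            simp only [mem_compl_iff, mem_ofPred_eq, not_le]; linarith
      _ = ENNReal.ofReal δ := by
          rw [measure_compl hm' (measure_ne_top _ _), measure_univ,
            measure_cdf_le q hq ⟨by linarith, by linarith⟩, ← ENNReal.ofReal_one,
            ← ENNReal.ofReal_sub _ (by linarith)]
          congr 1; ring
      _ < ε := hδ
  have h0' : ∀ᵐ t ∂q, ¬ cdf q t ≤ 0 := by simpa [ae_iff] using h0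
  have h1' : ∀ᵐ t ∂q, ¬ 1 ≤ cdf q t := by simpa [ae_iff] using h1
  filter_upwards [h0', h1'] with t ht0 ht1
  exact ⟨not_le.1 ht0, not_le.1 ht1⟩

/-- Without atoms, `cdf q` is uniformly distributed under `q`, and the quantile function takes the
uniform law to the Gaussian one. -/
theorem map_gaussianQuantile_cdf (q : Measure ℝ) [IsProbabilityMeasure q]
    (hq : ∀ t, q {t} = 0) :
    q.map (fun t => gaussianQuantile (cdf q t)) = gaussianReal 0 1 := by
  have hm : Measurable fun t => gaussianQuantile (cdf q t) :=
    measurable_gaussianQuantile.comp (cdf q).mono.measurable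
  have : IsProbabilityMeasure (q.map fun t => gaussianQuantile (cdf q t)) :=
    Measure.isProbabilityMeasure_map hm.aemeasurable
  refine Measure.ext_of_Iic _ _ fun a => ?_
  rw [Measure.map_apply hm measurableSet_Iic, ← ofReal_cdf,
    ← measure_cdf_le q hq (cdf_gaussianReal_mem_Ioo a)]
  refine measure_congr ?_
  filter_upwards [ae_cdf_mem_Ioo q hq] with t ht
  exact propext (gaussianQuantile_le_iff ht a)

end GaussianQuantile

/-! ### One-dimensional transport to the Gaussian and integration by parts against it. -/

section GaussianTransport

open Set

theorem lintegral_sq_gaussianReal : ∫⁻ x, ENNReal.ofReal (x ^ 2) ∂(gaussianReal 0 1) = 1 := by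
  have h1 : Integrable (fun x : ℝ => x ^ 2) (gaussianReal 0 1) :=
    (memLp_id_gaussianReal (μ := 0) (v := 1) 2).integrable_sq
  have h2 : ∫ x, x ^ 2 ∂(gaussianReal 0 1) = 1 := by
    have h := variance_fun_id_gaussianReal (μ := 0) (v := 1)
    rw [variance_eq_integral measurable_id'.aemeasurable] at h
    simpa using h
  rw [← ofReal_integral_eq_lintegral_ofReal h1 (ae_of_all _ fun x => sq_nonneg x), h2,
    ENNReal.ofReal_one]

/-- Pulled back by the transport map `T`, this says that `φ(T)⁻¹ dq` acts as the measure `dT`,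
although `T` is never differentiated. -/
theorem setLIntegral_inv_gaussianPDF (s : Set ℝ) (hs : MeasurableSet s) :
    ∫⁻ x in s, (gaussianPDF 0 1 x)⁻¹ ∂(gaussianReal 0 1) = volume s := by
  have h := lintegral_withDensity_eq_lintegral_mul (volume.restrict s)
    (measurable_gaussianPDF 0 1) (g := fun x => (gaussianPDF 0 1 x)⁻¹)
    (measurable_gaussianPDF 0 1).inv
  rw [gaussianReal_of_var_ne_zero _ one_ne_zero, restrict_withDensity hs, h]
  have : ∀ x, (gaussianPDF 0 1 * fun x => (gaussianPDF 0 1 x)⁻¹) x = 1 := fun x =>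
    ENNReal.mul_inv_cancel (gaussianPDF_pos 0 one_ne_zero x).ne' gaussianPDF_ne_top
  simp [this]

/-- The increasing map that transports `q` to the standard Gaussian measure when `q` has no
atoms. -/
noncomputable def gaussianTransport (q : Measure ℝ) (t : ℝ) : ℝ := gaussianQuantile (cdf q t)

theorem measurable_gaussianTransport (q : Measure ℝ) : Measurable (gaussianTransport q) :=
  measurable_gaussianQuantile.comp (cdf q).mono.measurable

variable {q : Measure ℝ} [IsProbabilityMeasure q]

theorem lintegral_comp_gaussianTransport (hq : ∀ t, q {t} = 0) {φ : ℝ → ENNReal}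
    (hφ : Measurable φ) :
    ∫⁻ t, φ (gaussianTransport q t) ∂q = ∫⁻ x, φ x ∂(gaussianReal 0 1) := by
  rw [← map_gaussianQuantile_cdf q hq]
  exact (lintegral_map hφ (measurable_gaussianTransport q)).symm

theorem setLIntegral_inv_gaussianPDF_transport (hq : ∀ t, q {t} = 0) {s : Set ℝ}
    (hs : MeasurableSet s) :
    ∫⁻ t, s.indicator (fun x => (gaussianPDF 0 1 x)⁻¹) (gaussianTransport q t) ∂q
      = volume s := by
  rw [lintegral_comp_gaussianTransport hq
    (φ := s.indicator (fun x => (gaussianPDF 0 1 x)⁻¹))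
    ((measurable_gaussianPDF 0 1).inv.indicator hs),
    lintegral_indicator hs, setLIntegral_inv_gaussianPDF _ hs]

/-- By monotonicity `T` sends almost every point of this set into `(0, T s]`, and the integral of
`dT` over the preimage of that interval is its length. -/
theorem lintegral_inv_gaussianPDF_transport_right (hq : ∀ t, q {t} = 0) {s : ℝ}
    (hs : cdf q s ∈ Ioo (0 : ℝ) 1) :
    ∫⁻ t, {t | t < s ∧ 0 < gaussianTransport q t}.indicator
      (fun t => (gaussianPDF 0 1 (gaussianTransport q t))⁻¹) t ∂q
      ≤ ENNReal.ofReal (gaussianTransport q s) := by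
  have h := setLIntegral_inv_gaussianPDF_transport hq
    (measurableSet_Ioc (a := 0) (b := gaussianTransport q s))
  rw [Real.volume_Ioc, sub_zero] at h
  rw [← h]
  refine lintegral_mono_ae ?_
  filter_upwards [ae_cdf_mem_Ioo q hq] with t ht
  by_cases h1 : t < s ∧ 0 < gaussianTransport q t
  · rw [indicator_of_mem (by simpa using h1), indicator_of_mem]
    exact ⟨h1.2, gaussianQuantile_mono ht hs ((cdf q).mono h1.1.le)⟩
  · rw [indicator_of_notMem (by simpa using h1)]
    exact zero_le

theorem lintegral_inv_gaussianPDF_transport_left (hq : ∀ t, q {t} = 0) {s : ℝ}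
    (hs : cdf q s ∈ Ioo (0 : ℝ) 1) :
    ∫⁻ t, {t | s < t ∧ gaussianTransport q t < 0}.indicator
      (fun t => (gaussianPDF 0 1 (gaussianTransport q t))⁻¹) t ∂q
      ≤ ENNReal.ofReal (-gaussianTransport q s) := by
  have h := setLIntegral_inv_gaussianPDF_transport hq
    (measurableSet_Ico (a := gaussianTransport q s) (b := 0))
  rw [Real.volume_Ico, zero_sub] at h
  rw [← h]
  refine lintegral_mono_ae ?_
  filter_upwards [ae_cdf_mem_Ioo q hq] with t ht
  by_cases h1 : s < t ∧ gaussianTransport q t < 0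
  · rw [indicator_of_mem (by simpa using h1), indicator_of_mem]
    exact ⟨gaussianQuantile_mono hs ht ((cdf q).mono h1.1.le), h1.2⟩
  · rw [indicator_of_notMem (by simpa using h1)]
    exact zero_le

/-- Integration by parts against the derivative of the transport map, on the part of the line
that is described by the relation `r`. -/
theorem lintegral_mul_inv_gaussianPDF_transport_le {p β R : ℝ → ENNReal}
    {A : Set ℝ} (hA : MeasurableSet A) {r : ℝ → ℝ → Prop}
    (hr : MeasurableSet {z : ℝ × ℝ | r z.1 z.2})
    (hβ : Measurable β)
    (hpβ : ∀ᵐ t ∂q, p t ≤ ∫⁻ s, {s | r t s}.indicator β s)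
    (hR : ∀ᵐ s, β s ≠ 0 → ∫⁻ t, {t | r t s ∧ t ∈ A}.indicator
      (fun t => (gaussianPDF 0 1 (gaussianTransport q t))⁻¹) t ∂q ≤ R s) :
    ∫⁻ t in A, p t * (gaussianPDF 0 1 (gaussianTransport q t))⁻¹ ∂q ≤ ∫⁻ s, β s * R s := by
  have hw : Measurable fun t => (gaussianPDF 0 1 (gaussianTransport q t))⁻¹ :=
    ((measurable_gaussianPDF 0 1).comp (measurable_gaussianTransport q)).inv
  set w := fun t => (gaussianPDF 0 1 (gaussianTransport q t))⁻¹ with hwdef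
  -- Tonelli for this kernel is the integration by parts: bound `p t` by an integral of `β` over
  -- `s`, swap, and integrate `w dq`, that is `dT`, first.
  set k : ℝ × ℝ → ENNReal := {z : ℝ × ℝ | r z.1 z.2 ∧ z.1 ∈ A}.indicator
    (fun z => β z.2 * w z.1) with hk
  have hset : MeasurableSet {z : ℝ × ℝ | r z.1 z.2 ∧ z.1 ∈ A} :=
    hr.inter (measurable_fst hA)
  have hkm : Measurable k :=
    ((hβ.comp measurable_snd).mul (hw.comp measurable_fst)).indicator hset
  calc ∫⁻ t in A, p t * w t ∂q = ∫⁻ t, A.indicator (fun t => p t * w t) t ∂q :=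
        (lintegral_indicator hA _).symm
    _ ≤ ∫⁻ t, (∫⁻ s, k (t, s)) ∂q := by
        refine lintegral_mono_ae ?_
        filter_upwards [hpβ] with t ht
        by_cases htA : t ∈ A
        · rw [indicator_of_mem htA]
          calc p t * w t ≤ (∫⁻ s, {s | r t s}.indicator β s) * w t := by gcongr
            _ = ∫⁻ s, {s | r t s}.indicator β s * w t :=
                (lintegral_mul_const _ (hβ.indicator
                  (measurable_prodMk_left (x := t) hr))).symm
            _ = ∫⁻ s, k (t, s) := by
                refine lintegral_congr fun s => ?_
                by_cases hts : r t s
                · rw [hk, indicator_of_mem (by simpa using hts),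
                    indicator_of_mem (by simpa using ⟨hts, htA⟩)]
                · rw [hk, indicator_of_notMem (by simpa using hts),
                    indicator_of_notMem (by simp [hts]), zero_mul]
        · rw [indicator_of_notMem htA]
          exact zero_le
    _ = ∫⁻ s, ∫⁻ t, k (t, s) ∂q := 
        lintegral_lintegral_swap (f := fun t s => k (t, s)) hkm.aemeasurable
    _ ≤ ∫⁻ s, β s * R s := by
        refine lintegral_mono_ae ?_
        filter_upwards [hR] with s hs
        calc ∫⁻ t, k (t, s) ∂q
            = ∫⁻ t, β s * {t | r t s ∧ t ∈ A}.indicator w t ∂q := by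
              refine lintegral_congr fun t => ?_
              by_cases hts : r t s ∧ t ∈ A
              · rw [hk, indicator_of_mem (by simpa using hts),
                  indicator_of_mem (by simpa using hts)]
              · rw [hk, indicator_of_notMem (by simpa using hts),
                  indicator_of_notMem (by simpa using hts), mul_zero]
          _ = β s * ∫⁻ t, {t | r t s ∧ t ∈ A}.indicator w t ∂q :=
              lintegral_const_mul _ (hw.indicator (measurable_prodMk_right (y := s) hset))
          _ ≤ β s * R s := by
              by_cases h0 : β s = 0
              · simp [h0]
              · gcongr
                exact hs h0

/-- The one-dimensional estimate behind the logarithmic Sobolev inequality. -/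
theorem lintegral_density_div_gaussianPDF_transport_le {p β K : ℝ → ENNReal} {m : ENNReal}
    (hq : q = volume.withDensity fun t => p t / m) (hm0 : m ≠ 0) (hmt : m ≠ ⊤)
    (hp : Measurable p) (hβ : Measurable β)
    (hr : ∀ᵐ t, p t ≤ ∫⁻ s in Ioi t, β s) (hl : ∀ᵐ t, p t ≤ ∫⁻ s in Iio t, β s)
    (hK : ∀ᵐ s, ∀ r : ℝ, 0 ≤ r →
      β s * ENNReal.ofReal r ≤ (K s + ENNReal.ofReal (r ^ 2) * p s) / 2)
    (h0 : ∀ s, p s = 0 → β s = 0) :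
    ∫⁻ t, p t * (gaussianPDF 0 1 (gaussianTransport q t))⁻¹ ∂q ≤ ((∫⁻ s, K s) + m) / 2 := by
  have hac : q ≪ volume := hq ▸ withDensity_absolutelyContinuous _ _
  have hqa : ∀ t, q {t} = 0 := fun t => hac (by simp)
  have hT := measurable_gaussianTransport q
  -- The `q`-almost sure statement becomes a Lebesgue-almost sure one where `p ≠ 0`, hence where `β
  -- ≠ 0`.
  have hcdf : ∀ᵐ s, β s ≠ 0 → cdf q s ∈ Ioo (0 : ℝ) 1 := by
    have h := ae_cdf_mem_Ioo q hqa
    conv at h => rw [hq]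
    rw [ae_withDensity_iff (hp.div_const m)] at h
    rw [← hq] at h
    filter_upwards [h] with s hs hβs
    refine hs fun h => hβs (h0 s ?_)
    simpa [hmt] using h
  -- Where `T > 0` the density is bounded by its variation to the right, where `T < 0` by its
  -- variation to the left. Then `dT` is always integrated between the zero level of `T` and `T s`,
  -- which gives the positive and negative parts of `T s`.
  have hR := lintegral_mul_inv_gaussianPDF_transport_le (q := q) (p := p) (β := β)
    (R := fun s => ENNReal.ofReal (gaussianTransport q s))
    (A := {t | 0 < gaussianTransport q t}) (r := fun t s => t < s)
    (measurableSet_lt measurable_const hT) (measurableSet_lt measurable_fst measurable_snd)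
    hβ (by
      filter_upwards [hac.ae_le hr] with t ht
      rwa [← lintegral_indicator measurableSet_Ioi] at ht) (by
      filter_upwards [hcdf] with s hs hβs
      exact lintegral_inv_gaussianPDF_transport_right hqa (hs hβs))
  have hL := lintegral_mul_inv_gaussianPDF_transport_le (q := q) (p := p) (β := β)
    (R := fun s => ENNReal.ofReal (-gaussianTransport q s))
    (A := {t | gaussianTransport q t < 0}) (r := fun t s => s < t)
    (measurableSet_lt hT measurable_const) (measurableSet_lt measurable_snd measurable_fst)
    hβ (by
      filter_upwards [hac.ae_le hl] with t ht
      rwa [← lintegral_indicator measurableSet_Iio] at ht) (by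
      filter_upwards [hcdf] with s hs hβs
      exact lintegral_inv_gaussianPDF_transport_left hqa (hs hβs))
  have hz : ∀ᵐ t ∂q, gaussianTransport q t ≠ 0 := by
    have h : ∀ᵐ x ∂(gaussianReal 0 1), x ≠ 0 := by
      simpa [ae_iff] using gaussianReal_singleton 0
    rw [← map_gaussianQuantile_cdf q hqa] at h
    exact ae_of_ae_map hT.aemeasurable h
  have hsplit : ∫⁻ t, p t * (gaussianPDF 0 1 (gaussianTransport q t))⁻¹ ∂q
      = ∫⁻ t in {t | 0 < gaussianTransport q t},
          p t * (gaussianPDF 0 1 (gaussianTransport q t))⁻¹ ∂q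
        + ∫⁻ t in {t | gaussianTransport q t < 0},
          p t * (gaussianPDF 0 1 (gaussianTransport q t))⁻¹ ∂q := by
    rw [← lintegral_add_compl _ (measurableSet_lt measurable_const hT :
      MeasurableSet {t | 0 < gaussianTransport q t})]
    congr 1
    refine setLIntegral_congr ?_
    filter_upwards [hz] with t ht
    refine propext ?_
    change ¬ (0 < gaussianTransport q t) ↔ gaussianTransport q t < 0
    exact ⟨fun h => lt_of_le_of_ne (not_lt.1 h) ht, fun h => not_lt.2 h.le⟩
  have hsq : ∫⁻ s, ENNReal.ofReal (gaussianTransport q s ^ 2) * p s = m := by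
    have h : ∫⁻ s, ENNReal.ofReal (gaussianTransport q s ^ 2) ∂q = 1 :=
      (lintegral_comp_gaussianTransport hqa
        (φ := fun x => ENNReal.ofReal (x ^ 2)) (by fun_prop)).trans lintegral_sq_gaussianReal
    have hTm : Measurable fun s => ENNReal.ofReal (gaussianTransport q s ^ 2) := by fun_prop
    have h2 : ∫⁻ s, ENNReal.ofReal (gaussianTransport q s ^ 2) ∂q =
        ∫⁻ s, (p s / m) * ENNReal.ofReal (gaussianTransport q s ^ 2) := by
      conv_lhs => rw [hq]
      rw [lintegral_withDensity_eq_lintegral_mul _ (hp.div_const m)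
        (by rw [← hq]; exact hTm)]
      rw [← hq]
      rfl
    calc ∫⁻ s, ENNReal.ofReal (gaussianTransport q s ^ 2) * p s
        = ∫⁻ s, m * ((p s / m) * ENNReal.ofReal (gaussianTransport q s ^ 2)) := by
          refine lintegral_congr fun s => ?_
          rw [← mul_assoc, ENNReal.mul_div_cancel hm0 hmt, mul_comm]
      _ = m := by
          rw [lintegral_const_mul _ (f := fun s => p s / m *
            ENNReal.ofReal (gaussianTransport q s ^ 2)) ((hp.div_const m).mul hTm),
          ← h2, h, mul_one]
  calc _ ≤ (∫⁻ s, β s * ENNReal.ofReal (gaussianTransport q s))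
        + ∫⁻ s, β s * ENNReal.ofReal (-gaussianTransport q s) := by
        rw [hsplit]
        exact add_le_add hR hL
    _ = ∫⁻ s, (β s * ENNReal.ofReal (gaussianTransport q s)
        + β s * ENNReal.ofReal (-gaussianTransport q s)) :=
        (lintegral_add_left (f := fun s => β s * ENNReal.ofReal (gaussianTransport q s))
          (hβ.mul hT.ennreal_ofReal) _).symm
    _ ≤ ∫⁻ s, (K s + ENNReal.ofReal (gaussianTransport q s ^ 2) * p s) / 2 := by
        refine lintegral_mono_ae ?_
        filter_upwards [hK] with s hs
        rcases le_total 0 (gaussianTransport q s) with h | h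
        · rw [ENNReal.ofReal_of_nonpos (neg_nonpos.2 h), mul_zero, add_zero]
          exact hs _ h
        · rw [ENNReal.ofReal_of_nonpos h, mul_zero, zero_add, ← neg_sq]
          exact hs _ (neg_nonneg.2 h)
    _ = ((∫⁻ s, K s) + m) / 2 := by
        simp_rw [div_eq_mul_inv]
        rw [lintegral_mul_const' _ _ (by simp), lintegral_add_right _ (by fun_prop), hsq]

end GaussianTransport

/-! ### Pointwise bound for a conditional log-density. -/

section ConditionalEstimate

open Set

/-- If `g t` exceeded the total variation `c` of `g` on `(t, ∞)`, then `g ≥ g t - c > 0` there and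
`g` would have infinite integral. -/
theorem ofReal_le_setLIntegral_Ioi_deriv {g v : ℝ → ℝ}
    (hv : Measurable v) (hd : ∀ t, HasDerivAt g (v t) t)
    (hfin : ∫⁻ t, ENNReal.ofReal (g t) ≠ ⊤) (t : ℝ) :
    ENNReal.ofReal (g t) ≤ ∫⁻ s in Ioi t, ENNReal.ofReal |v s| := by
  by_contra! hlt
  have hint : IntegrableOn v (Ioi t) := by
    refine ⟨hv.aestronglyMeasurable, ?_⟩
    rw [hasFiniteIntegral_iff_norm]
    exact hlt.trans_le le_top
  set c := ∫ s in Ioi t, |v s| with hc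
  have hcv : ∫⁻ s in Ioi t, ENNReal.ofReal |v s| = ENNReal.ofReal c :=
    (ofReal_integral_eq_lintegral_ofReal hint.abs (ae_of_all _ fun s => abs_nonneg _)).symm
  rw [hcv, ENNReal.ofReal_lt_ofReal_iff'] at hlt
  have hlow : ∀ s ∈ Ioi t, g t - c ≤ g s := by
    intro s hs
    have hsub : IntegrableOn v (Ioc t s) := hint.mono_set Ioc_subset_Ioi_self
    have h1 : ∫ r in t..s, v r = g s - g t :=
      intervalIntegral.integral_eq_sub_of_hasDerivAt (fun r _ => hd r)
        ((intervalIntegrable_iff_integrableOn_Ioc_of_le (le_of_lt hs)).2 hsub)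
    have h2 : |∫ r in t..s, v r| ≤ c := by
      rw [intervalIntegral.integral_of_le (le_of_lt hs)]
      refine (abs_integral_le_integral_abs).trans ?_
      exact setIntegral_mono_set hint.abs (ae_of_all _ fun s => abs_nonneg _)
        (LE.le.eventuallyLE Ioc_subset_Ioi_self)
    rw [h1] at h2
    linarith [(abs_le.1 h2).1]
  refine hfin (top_le_iff.1 ?_)
  calc (⊤ : ENNReal) = ∫⁻ s in Ioi t, ENNReal.ofReal (g t - c) := by
        rw [setLIntegral_const, Real.volume_Ioi, ENNReal.mul_top]
        simpa using hlt.1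
    _ ≤ ∫⁻ s in Ioi t, ENNReal.ofReal (g s) :=
        setLIntegral_mono' measurableSet_Ioi fun s hs => ENNReal.ofReal_le_ofReal (hlow s hs)
    _ ≤ ∫⁻ s, ENNReal.ofReal (g s) := setLIntegral_le_lintegral _ _

theorem ofReal_le_setLIntegral_Iio_deriv {g v : ℝ → ℝ}
    (hv : Measurable v) (hd : ∀ t, HasDerivAt g (v t) t)
    (hfin : ∫⁻ t, ENNReal.ofReal (g t) ≠ ⊤) (t : ℝ) :
    ENNReal.ofReal (g t) ≤ ∫⁻ s in Iio t, ENNReal.ofReal |v s| := by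
  have h := ofReal_le_setLIntegral_Ioi_deriv (g := fun s => g (-s)) (v := fun s => -v (-s))
    (hv.comp measurable_neg).neg (fun s => by
      simpa [Function.comp_def] using (hd (-s)).comp s (hasDerivAt_neg s))
    (by rwa [lintegral_neg_eq_self (fun t => ENNReal.ofReal (g t))]) (-t)
  rw [neg_neg] at h
  refine h.trans_eq ?_
  rw [← lintegral_indicator measurableSet_Ioi, ← lintegral_indicator measurableSet_Iio,
    ← lintegral_neg_eq_self]
  refine lintegral_congr fun s => ?_
  by_cases hs : s < t
  · rw [indicator_of_mem (by simpa using hs), indicator_of_mem (by simpa using hs)]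
    simp
  · rw [indicator_of_notMem (by simpa using hs), indicator_of_notMem (by simpa using hs)]

/-- This is `log x ≤ x - 1` at `x = r / φ(T)`. For a density `r` and its transport map `T` to the
Gaussian, `x` is formally `T'`. -/
theorem log_le_div_gaussianPDFReal_sub {r : ℝ} (hr : 0 < r) (T : ℝ) :
    Real.log r ≤ r * (gaussianPDFReal 0 1 T)⁻¹ - (T ^ 2 / 2 + Real.log (2 * Real.pi) / 2 + 1) := by
  have hpos := gaussianPDFReal_pos 0 1 T one_ne_zero
  have h1 := Real.log_le_sub_one_of_pos (mul_pos hr (inv_pos.2 hpos))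
  rw [Real.log_mul hr.ne' (inv_pos.2 hpos).ne', Real.log_inv] at h1
  have h2 : Real.log (gaussianPDFReal 0 1 T) = -(T ^ 2 / 2) - Real.log (2 * Real.pi) / 2 := by
    rw [gaussianPDFReal_def, Real.log_mul (by positivity) (Real.exp_pos _).ne', Real.log_exp,
      Real.log_inv, Real.log_sqrt (by positivity)]
    simp only [NNReal.coe_one, mul_one, sub_zero]
    ring
  linarith

variable {X : Type*} [MeasurableSpace X]

/-- The one-dimensional estimate is applied on each fibre and integrated over `x`. Producing a
majorant `w`, rather than bounding the integral of the logarithm, avoids assuming that the logarithm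
is integrable. -/
theorem exists_conditional_log_density_bound (μ : Measure X) [SFinite μ] {p β K : ℝ × X → ENNReal}
    (hp : Measurable p) (hβ : Measurable β)
    (hp1 : ∫⁻ x, (∫⁻ t, p (t, x)) ∂μ = 1)
    (hKfin : ∫⁻ x, (∫⁻ t, K (t, x)) ∂μ ≠ ⊤)
    (hr : ∀ᵐ x ∂μ, ∀ t, p (t, x) ≤ ∫⁻ s in Ioi t, β (s, x))
    (hl : ∀ᵐ x ∂μ, ∀ t, p (t, x) ≤ ∫⁻ s in Iio t, β (s, x))
    (hβK : ∀ z, ∀ r : ℝ, 0 ≤ r →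
      β z * ENNReal.ofReal r ≤ (K z + ENNReal.ofReal (r ^ 2) * p z) / 2)
    (h0 : ∀ z, p z = 0 → β z = 0) :
    ∃ w : ℝ × X → ℝ, Measurable w ∧ Integrable w ((volume.prod μ).withDensity p) ∧
      (∀ᵐ z ∂((volume.prod μ).withDensity p),
        Real.log (p z).toReal - Real.log (∫⁻ t, p (t, z.2)).toReal ≤ w z) ∧
      ∫ z, w z ∂((volume.prod μ).withDensity p) ≤
        (∫⁻ x, (∫⁻ t, K (t, x)) ∂μ).toReal / 2 - (Real.log (2 * Real.pi) / 2 + 1) := by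
  set m : X → ENNReal := fun x => ∫⁻ t, p (t, x) with hm
  have hmm : Measurable m := hp.lintegral_prod_left'
  -- Conditional distribution function of `t` given `x`, written as an integral with parameters to
  -- obtain joint measurability of the transport maps.
  set F : ℝ × X → ℝ := fun z => (∫⁻ s in Iic z.1, p (s, z.2) / m z.2).toReal with hF
  have hFm : Measurable F := by
    refine Measurable.ennreal_toReal ?_
    have : ∀ z : ℝ × X, ∫⁻ s in Iic z.1, p (s, z.2) / m z.2 =
        ∫⁻ s, {y : (ℝ × X) × ℝ | y.2 ≤ y.1.1}.indicator
          (fun y => p (y.2, y.1.2) / m y.1.2) (z, s) := by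
      intro z
      rw [← lintegral_indicator measurableSet_Iic]
      refine lintegral_congr fun s => ?_
      by_cases hs : s ≤ z.1
      · rw [indicator_of_mem (by simpa using hs), indicator_of_mem (by simpa using hs)]
      · rw [indicator_of_notMem (by simpa using hs), indicator_of_notMem (by simpa using hs)]
    simp_rw [this]
    refine Measurable.lintegral_prod_right' (f := {y : (ℝ × X) × ℝ | y.2 ≤ y.1.1}.indicator
          (fun y => p (y.2, y.1.2) / m y.1.2)) ?_
    refine Measurable.indicator ?_ (measurableSet_le measurable_snd (by fun_prop))
    exact (hp.comp (by fun_prop)).div (hmm.comp (by fun_prop))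
  set T : ℝ × X → ℝ := fun z => gaussianQuantile (F z) with hT
  have hTm : Measurable T := measurable_gaussianQuantile.comp hFm
  -- Formally the `t`-derivative of `T`: conditional density divided by the Gaussian density at the
  -- image point.
  set E : ℝ × X → ENNReal := fun z => p z / m z.2 * (gaussianPDF 0 1 (T z))⁻¹ with hE
  have hEm : Measurable E := (hp.div (hmm.comp measurable_snd)).mul
    ((measurable_gaussianPDF 0 1).comp hTm).inv
  set ν := (volume.prod μ).withDensity p with hν
  have hint : ∀ φ : ℝ × X → ENNReal, Measurable φ →
      ∫⁻ z, φ z ∂ν = ∫⁻ x, (∫⁻ t, p (t, x) * φ (t, x)) ∂μ := by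
    intro φ hφ
    rw [hν, lintegral_withDensity_eq_lintegral_mul _ hp hφ,
      lintegral_prod_symm' _ (hp.mul hφ)]
    rfl
  have hmfin : ∀ᵐ x ∂μ, m x < ⊤ := ae_lt_top hmm (by rw [hp1]; exact ENNReal.one_ne_top)
  have hprob : IsProbabilityMeasure ν := ⟨by
    have := hint (fun _ => 1) measurable_const
    simp only [lintegral_const, one_mul, mul_one] at this
    exact this.trans hp1⟩
  have hq : ∀ x, m x ≠ 0 → m x < ⊤ → ∃ q : Measure ℝ, ∃ _ : IsProbabilityMeasure q,
      q = volume.withDensity (fun t => p (t, x) / m x) ∧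
      ∀ t, gaussianTransport q t = T (t, x) := by
    intro x hx0 hxt
    have hpx : Measurable fun t => p (t, x) := hp.comp (by fun_prop)
    have hpr : IsProbabilityMeasure (volume.withDensity (fun t => p (t, x) / m x)) := ⟨by
      rw [withDensity_apply _ MeasurableSet.univ, setLIntegral_univ]
      simp_rw [div_eq_mul_inv]
      rw [lintegral_mul_const _ hpx]
      exact ENNReal.mul_inv_cancel hx0 hxt.ne⟩
    refine ⟨_, hpr, rfl, fun t => ?_⟩
    rw [hT, hF, gaussianTransport, cdf_eq_real, Measure.real, withDensity_apply _ measurableSet_Iic]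
  have hpq : ∀ x, m x ≠ 0 → m x < ⊤ → ∀ φ : ℝ → ENNReal, Measurable φ →
      ∫⁻ t, p (t, x) * φ t = m x *
        ∫⁻ t, φ t ∂(volume.withDensity (fun t => p (t, x) / m x)) := by
    intro x hx0 hxt φ hφ
    have hpx : Measurable fun t => p (t, x) := hp.comp (by fun_prop)
    rw [lintegral_withDensity_eq_lintegral_mul _ (hpx.div_const _) hφ, ← lintegral_const_mul _
      ((hpx.div_const _).mul hφ)]
    refine lintegral_congr fun t => ?_
    rw [Pi.mul_apply, ← mul_assoc, ENNReal.mul_div_cancel hx0 hxt.ne]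
  have hzero : ∀ x, m x = 0 → ∀ φ : ℝ → ENNReal, ∫⁻ t, p (t, x) * φ t = 0 := by
    intro x hx φ
    have hpx : Measurable fun t => p (t, x) := hp.comp (by fun_prop)
    have := (lintegral_eq_zero_iff hpx).1 hx
    rw [lintegral_congr_ae (g := fun _ => 0), lintegral_zero]
    filter_upwards [this] with t ht
    simp only [Pi.zero_apply] at ht
    simp [ht]
  have hE1 : ∫⁻ z, ENNReal.ofReal (T z ^ 2) ∂ν = 1 := by
    rw [hint _ (by fun_prop), ← hp1]
    refine lintegral_congr_ae ?_
    filter_upwards [hmfin] with x hxt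
    by_cases hx0 : m x = 0
    · rw [hzero x hx0]; exact hx0.symm
    obtain ⟨q, hqp, hqd, hqT⟩ := hq x hx0 hxt
    have hqa : ∀ t, q {t} = 0 := fun t => by
      rw [hqd]; exact withDensity_absolutelyContinuous _ _ (by simp)
    rw [hpq x hx0 hxt (fun t => ENNReal.ofReal (T (t, x) ^ 2)) (by fun_prop), ← hqd]
    simp_rw [← hqT]
    rw [lintegral_comp_gaussianTransport hqa (φ := fun x => ENNReal.ofReal (x ^ 2))
      (by fun_prop), lintegral_sq_gaussianReal, mul_one]
  have hE2 : ∫⁻ z, E z ∂ν ≤ ((∫⁻ x, (∫⁻ t, K (t, x)) ∂μ) + 1) / 2 := by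
    rw [hint _ hEm]
    calc _ ≤ ∫⁻ x, ((∫⁻ t, K (t, x)) + m x) / 2 ∂μ := by
          refine lintegral_mono_ae ?_
          filter_upwards [hmfin, hr, hl] with x hxt hxr hxl
          by_cases hx0 : m x = 0
          · rw [hzero x hx0 (fun t => E (t, x))]; exact zero_le
          obtain ⟨q, hqp, hqd, hqT⟩ := hq x hx0 hxt
          have h := lintegral_density_div_gaussianPDF_transport_le (p := fun t => p (t, x))
            (β := fun t => β (t, x)) (K := fun t => K (t, x)) hqd hx0 hxt.ne
            (hp.comp (by fun_prop)) (hβ.comp (by fun_prop)) (ae_of_all _ hxr) (ae_of_all _ hxl)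
            (ae_of_all _ fun s => hβK (s, x)) (fun s => h0 (s, x))
          rw [hpq x hx0 hxt (fun t => E (t, x)) (hEm.comp (by fun_prop)), ← hqd,
            ← lintegral_const_mul (f := fun t => E (t, x)) _ (hEm.comp (by fun_prop))]
          refine le_trans (le_of_eq ?_) h
          refine lintegral_congr fun t => ?_
          rw [hE, hqT]
          change m x * (p (t, x) / m x * _) = _
          rw [← mul_assoc, ENNReal.mul_div_cancel hx0 hxt.ne]
      _ = _ := by
          simp_rw [div_eq_mul_inv]
          rw [lintegral_mul_const' _ _ (by simp), lintegral_add_right _ hmm, hp1]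
  have hE2fin : ∫⁻ z, E z ∂ν ≠ ⊤ :=
    ne_top_of_le_ne_top (ENNReal.div_ne_top (by simp [hKfin]) (by simp)) hE2
  have hEint : Integrable (fun z => (E z).toReal) ν :=
    integrable_toReal_of_lintegral_ne_top hEm.aemeasurable hE2fin
  have hTint : Integrable (fun z => T z ^ 2) ν := by
    refine ⟨by fun_prop, ?_⟩
    rw [hasFiniteIntegral_iff_ofReal (ae_of_all _ fun z => sq_nonneg _), hE1]
    exact ENNReal.one_lt_top
  refine ⟨fun z => (E z).toReal - (T z ^ 2 / 2 + Real.log (2 * Real.pi) / 2 + 1), by fun_prop,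
    by fun_prop, ?_, ?_⟩
  · have hmz : ∀ᵐ z ∂ν, m z.2 ≠ 0 := by
      have hs : MeasurableSet {z : ℝ × X | m z.2 = 0} :=
        (hmm.comp measurable_snd) (measurableSet_singleton 0)
      suffices h : ν {z : ℝ × X | m z.2 = 0} = 0 by simpa [ae_iff] using h
      rw [← lintegral_indicator_one hs, hint _ (measurable_one.indicator hs)]
      refine lintegral_eq_zero_of_ae_eq_zero (ae_of_all _ fun x => ?_)
      by_cases hx : m x = 0
      · exact hzero x hx _
      · simp [indicator, hx]
    have hmz' : ∀ᵐ z ∂ν, m z.2 < ⊤ := by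
      refine (withDensity_absolutelyContinuous _ _).ae_le ?_
      exact Measure.quasiMeasurePreserving_snd.ae hmfin
    have hpz : ∀ᵐ z ∂ν, p z ≠ 0 := by
      rw [hν, ae_withDensity_iff hp]
      exact ae_of_all _ fun z h => h
    have hpz' : ∀ᵐ z ∂ν, p z < ⊤ := by
      refine (withDensity_absolutelyContinuous _ _).ae_le ?_
      refine ae_lt_top hp ?_
      rw [lintegral_prod_symm' _ hp, hp1]
      exact ENNReal.one_ne_top
    filter_upwards [hmz, hmz', hpz, hpz'] with z h1 h2 h3 h4
    rw [← Real.log_div (ENNReal.toReal_pos h3 h4.ne).ne' (ENNReal.toReal_pos h1 h2.ne).ne',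
      ← ENNReal.toReal_div]
    refine (log_le_div_gaussianPDFReal_sub
      (ENNReal.toReal_pos (ENNReal.div_ne_zero.2 ⟨h3, h2.ne⟩)
        (ENNReal.div_ne_top h4.ne h1)) (T z)).trans (le_of_eq ?_)
    rw [hE]
    simp only [ENNReal.toReal_mul, ENNReal.toReal_inv, toReal_gaussianPDF]
  · have hT1 : ∫ z, T z ^ 2 ∂ν = 1 := by
      rw [integral_eq_lintegral_of_nonneg_ae (ae_of_all _ fun z => sq_nonneg _) (by fun_prop), hE1]
      rfl
    have hE3 : ∫ z, (E z).toReal ∂ν ≤ ((∫⁻ x, (∫⁻ t, K (t, x)) ∂μ).toReal + 1) / 2 := by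
      rw [integral_toReal hEm.aemeasurable (ae_lt_top hEm hE2fin)]
      refine (ENNReal.toReal_mono (ENNReal.div_ne_top (by simp [hKfin]) (by simp)) hE2).trans ?_
      rw [ENNReal.toReal_div, ENNReal.toReal_add hKfin ENNReal.one_ne_top]
      simp
    rw [integral_sub hEint (by fun_prop), integral_add (by fun_prop) (by fun_prop),
      integral_add (by fun_prop) (by fun_prop), integral_div, hT1]
    simp only [integral_const, probReal_univ, one_smul]
    linarith

end ConditionalEstimate

/-! ### Induction on coordinates for the logarithmic Sobolev inequality. -/

section LogSobolev

open Set

theorem MeasureTheory.MeasurePreserving.withDensity_comp {α β : Type*} [MeasurableSpace α]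
    [MeasurableSpace β] {μ : Measure α} {ν : Measure β} {e : α → β} (he : MeasurePreserving e μ ν)
    {p : β → ENNReal} (hp : Measurable p) :
    MeasurePreserving e (μ.withDensity fun x => p (e x)) (ν.withDensity p) := by
  refine ⟨he.measurable, Measure.ext fun s hs => ?_⟩
  rw [Measure.map_apply he.measurable hs, withDensity_apply _ (he.measurable hs),
    withDensity_apply _ hs, he.setLIntegral_comp_preimage hs hp]

theorem measurePreserving_snd_withDensity {α β : Type*} [MeasurableSpace α]
    [MeasurableSpace β] {μ : Measure α} {ν : Measure β} [SFinite μ] [SFinite ν]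
    {p : α × β → ENNReal} (hp : Measurable p) :
    MeasurePreserving Prod.snd ((μ.prod ν).withDensity p)
      (ν.withDensity fun y => ∫⁻ x, p (x, y) ∂μ) := by
  refine ⟨measurable_snd, Measure.ext fun s hs => ?_⟩
  rw [Measure.map_apply measurable_snd hs, withDensity_apply _ (measurable_snd hs),
    withDensity_apply _ hs, ← lintegral_indicator (measurable_snd hs), ← lintegral_indicator hs,
    lintegral_prod_symm' _ (hp.indicator (measurable_snd hs))]
  refine lintegral_congr fun y => ?_
  by_cases hy : y ∈ s
  · rw [indicator_of_mem hy]
    refine lintegral_congr fun x => ?_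
    rw [indicator_of_mem (by simpa using hy)]
  · rw [indicator_of_notMem hy]
    refine lintegral_eq_zero_of_ae_eq_zero (ae_of_all _ fun x => ?_)
    simp [indicator, hy]

/-- Young's inequality, from `(|v| - r g)² / g ≥ 0`. Since `v ^ 2 / 0 = 0`, zeros of `g` require `v
= 0`, which holds for the derivative of a nonnegative function. -/
theorem ofReal_abs_mul_le {g v r : ℝ} (hg : 0 ≤ g) (hv : g = 0 → v = 0) :
    ENNReal.ofReal |v| * ENNReal.ofReal r ≤
      (ENNReal.ofReal (v ^ 2 / g) + ENNReal.ofReal (r ^ 2) * ENNReal.ofReal g) / 2 := by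
  have h2 : (2 : ENNReal) = ENNReal.ofReal 2 := by simp
  rw [← ENNReal.ofReal_mul (abs_nonneg _), ← ENNReal.ofReal_mul (sq_nonneg r),
    ← ENNReal.ofReal_add (by positivity) (by positivity), h2,
    ← ENNReal.ofReal_div_of_pos (by norm_num)]
  refine ENNReal.ofReal_le_ofReal ?_
  rcases hg.eq_or_lt with h | h
  · simp [hv h.symm, ← h]
  · rw [le_div_iff₀ (by norm_num), ← sub_nonneg]
    have : v ^ 2 / g + r ^ 2 * g - |v| * r * 2 = (|v| - r * g) ^ 2 / g := by
      rw [← sq_abs v]; field_simp; ring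
    rw [this]
    positivity

theorem HasDerivAt.eq_zero_of_nonneg {g : ℝ → ℝ} {v t : ℝ} (hg : ∀ s, 0 ≤ g s)
    (hd : HasDerivAt g v t) (h0 : g t = 0) : v = 0 :=
  IsLocalMin.hasDerivAt_eq_zero (Filter.Eventually.of_forall fun s => h0 ▸ hg s) hd

/-- Chain rule for entropy: the log-density is the conditional log-density plus the marginal one,
and their majorants add. -/
theorem exists_log_bound_of_marginal {α X : Type*} [MeasurableSpace α] [MeasurableSpace X]
    {κ : Measure α} {ρ : Measure ℝ} {μ : Measure X} [SFinite ρ] [SFinite μ] (e : α ≃ᵐ ℝ × X)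
    (he : MeasurePreserving e κ (ρ.prod μ)) {p : ℝ × X → ENNReal} (hp : Measurable p)
    {w₁ : ℝ × X → ℝ} {w₂ : X → ℝ} (hw₁m : Measurable w₁)
    (hw₁i : Integrable w₁ ((ρ.prod μ).withDensity p))
    (hw₁le : ∀ᵐ z ∂((ρ.prod μ).withDensity p),
      Real.log (p z).toReal - Real.log (∫⁻ t, p (t, z.2) ∂ρ).toReal ≤ w₁ z)
    (hw₂m : Measurable w₂) (hw₂i : Integrable w₂ (μ.withDensity fun x => ∫⁻ t, p (t, x) ∂ρ))
    (hw₂le : ∀ᵐ x ∂(μ.withDensity fun x => ∫⁻ t, p (t, x) ∂ρ),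
      Real.log (∫⁻ t, p (t, x) ∂ρ).toReal ≤ w₂ x) :
    ∃ w : α → ℝ, Measurable w ∧ Integrable w (κ.withDensity fun a => p (e a)) ∧
      (∀ᵐ a ∂(κ.withDensity fun a => p (e a)), Real.log (p (e a)).toReal ≤ w a) ∧
      ∫ a, w a ∂(κ.withDensity fun a => p (e a)) = (∫ z, w₁ z ∂((ρ.prod μ).withDensity p)) +
        ∫ x, w₂ x ∂(μ.withDensity fun x => ∫⁻ t, p (t, x) ∂ρ) := by
  have hepd := he.withDensity_comp hp
  have hsnd := measurePreserving_snd_withDensity (μ := ρ) (ν := μ) hp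
  have hw₂i' : Integrable (fun z : ℝ × X => w₂ z.2) ((ρ.prod μ).withDensity p) :=
    hsnd.integrable_comp_of_integrable hw₂i
  have hw₂' : ∫ z : ℝ × X, w₂ z.2 ∂((ρ.prod μ).withDensity p) =
      ∫ z, w₂ z ∂(μ.withDensity fun z => ∫⁻ t, p (t, z) ∂ρ) := by
    rw [← hsnd.map_eq, integral_map measurable_snd.aemeasurable hw₂m.aestronglyMeasurable]
  have hsum : Integrable (fun z : ℝ × X => w₁ z + w₂ z.2) ((ρ.prod μ).withDensity p) :=
    hw₁i.add hw₂i'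
  have hcomp : Integrable (fun a => w₁ (e a) + w₂ (e a).2) (κ.withDensity fun a => p (e a)) :=
    (hepd.integrable_comp_emb e.measurableEmbedding
      (g := fun z : ℝ × X => w₁ z + w₂ z.2)).2 hsum
  refine ⟨fun x => w₁ (e x) + w₂ (e x).2,
    (hw₁m.add (hw₂m.comp measurable_snd)).comp e.measurable,
    hcomp, ?_, ?_⟩
  · refine hepd.quasiMeasurePreserving.ae
      (p := fun z => Real.log (p z).toReal ≤ w₁ z + w₂ z.2) ?_
    have h2 : ∀ᵐ z ∂((ρ.prod μ).withDensity p),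
        Real.log (∫⁻ t, p (t, z.2) ∂ρ).toReal ≤ w₂ z.2 :=
      hsnd.quasiMeasurePreserving.ae hw₂le
    filter_upwards [hw₁le, h2] with z hz1 hz2
    linarith
  · rw [hepd.integral_comp' (g := fun z => w₁ z + w₂ z.2), integral_add hw₁i hw₂i', hw₂']

/-- A pointwise upper bound of the logarithm of a marginal density, whose integral is controlled
by the Fisher information. -/
theorem exists_log_density_bound (n : ℕ) : ∀ {Y : Type} [MeasurableSpace Y] (ρ : Measure Y)
    [SFinite ρ] (g : (Fin n → ℝ) × Y → ℝ) (v : Fin n → (Fin n → ℝ) × Y → ℝ),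
    (∀ z, 0 ≤ g z) → Measurable g → (∀ i, Measurable (v i)) →
    (∀ i x y, HasDerivAt (fun s => g (Function.update x i s, y)) (v i (x, y)) (x i)) →
    ∫⁻ x, (∫⁻ y, ENNReal.ofReal (g (x, y)) ∂ρ) = 1 →
    (∀ i, ∫⁻ x, (∫⁻ y, ENNReal.ofReal (v i (x, y) ^ 2 / g (x, y)) ∂ρ) ≠ ⊤) →
    ∃ w : (Fin n → ℝ) → ℝ, Measurable w ∧
      Integrable w (volume.withDensity fun x => ∫⁻ y, ENNReal.ofReal (g (x, y)) ∂ρ) ∧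
      (∀ᵐ x ∂(volume.withDensity fun x => ∫⁻ y, ENNReal.ofReal (g (x, y)) ∂ρ),
        Real.log (∫⁻ y, ENNReal.ofReal (g (x, y)) ∂ρ).toReal ≤ w x) ∧
      ∫ x, w x ∂(volume.withDensity fun x => ∫⁻ y, ENNReal.ofReal (g (x, y)) ∂ρ) ≤
        (∑ i, (∫⁻ x, (∫⁻ y, ENNReal.ofReal (v i (x, y) ^ 2 / g (x, y)) ∂ρ)).toReal) / 2
          - n * (Real.log (2 * Real.pi) / 2 + 1) := by
  induction n with
  | zero =>
    intro Y _ ρ _ g v hg hgm hvm hd h1 hfin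
    -- In dimension zero the space is a point of mass one, so the marginal density is `1` and its
    -- logarithm vanishes.
    refine ⟨0, measurable_const, integrable_zero _ _ _, ae_of_all _ fun x => ?_, by simp⟩
    have hv : (volume : Measure (Fin 0 → ℝ)) univ = 1 := by
      rw [volume_pi, Measure.pi_univ]; simp
    rw [lintegral_unique, hv, mul_one] at h1
    have h1' : ∫⁻ y, ENNReal.ofReal (g (x, y)) ∂ρ = 1 := by
      rw [← h1, Subsingleton.elim x]
    rw [h1']
    simp
  | succ n ih =>
    intro Y _ ρ _ g v hg hgm hvm hd h1 hfin
    set e := MeasurableEquiv.piFinSuccAbove (fun _ : Fin (n + 1) => ℝ) 0 with he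
    have hep : MeasurePreserving e volume (volume.prod volume) :=
      volume_preserving_piFinSuccAbove (fun _ : Fin (n + 1) => ℝ) 0
    have hes : ∀ z : ℝ × (Fin n → ℝ), e.symm z = Fin.cons z.1 z.2 := fun z => by
      simp [he, MeasurableEquiv.piFinSuccAbove, Fin.insertNthEquiv]
    have hcm : Measurable fun z : ℝ × (Fin n → ℝ) => (Fin.cons z.1 z.2 : Fin (n + 1) → ℝ) := by
      simpa only [← hes] using e.symm.measurable
    have hlint : ∀ φ : (Fin (n + 1) → ℝ) → ENNReal, Measurable φ →
        ∫⁻ x, φ x = ∫⁻ z : Fin n → ℝ, (∫⁻ t : ℝ, φ (Fin.cons t z)) := by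
      intro φ hφ
      rw [← hep.symm.lintegral_comp hφ,
        lintegral_prod_symm' (fun a => φ (e.symm a)) (hφ.comp e.symm.measurable)]
      simp only [hes]
    have hv0 : ∀ i z, g z = 0 → v i z = 0 := by
      intro i z hz
      refine (hd i z.1 z.2).eq_zero_of_nonneg (fun s => hg _) ?_
      simpa using hz
    set p : ℝ × (Fin n → ℝ) → ENNReal :=
      fun z => ∫⁻ y, ENNReal.ofReal (g (Fin.cons z.1 z.2, y)) ∂ρ with hp
    -- Averaging `|∂₀g|` over the hidden variable, instead of differentiating the average `p`,
    -- avoids differentiation under the integral sign.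
    set β : ℝ × (Fin n → ℝ) → ENNReal :=
      fun z => ∫⁻ y, ENNReal.ofReal |v 0 (Fin.cons z.1 z.2, y)| ∂ρ with hβ
    have hassoc : Measurable fun a : (ℝ × (Fin n → ℝ)) × Y =>
        ((Fin.cons a.1.1 a.1.2 : Fin (n + 1) → ℝ), a.2) :=
      (hcm.comp measurable_fst).prodMk measurable_snd
    have hassoc' : Measurable fun a : (Fin n → ℝ) × (ℝ × Y) =>
        ((Fin.cons a.2.1 a.1 : Fin (n + 1) → ℝ), a.2.2) :=
      (hcm.comp (f := fun a : (Fin n → ℝ) × (ℝ × Y) => (a.2.1, a.1)) (by fun_prop)).prodMk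
        (by fun_prop)
    have hpm : Measurable p :=
      (hgm.comp hassoc).ennreal_ofReal.lintegral_prod_right'
    have hβm : Measurable β :=
      Measurable.lintegral_prod_right' (f := fun a : (ℝ × (Fin n → ℝ)) × Y =>
        ENNReal.ofReal |v 0 (Fin.cons a.1.1 a.1.2, a.2)|)
        ((hvm 0).comp hassoc).abs.ennreal_ofReal
    have hp1 : ∫⁻ z : Fin n → ℝ, (∫⁻ t, p (t, z)) = 1 := by
      rw [← h1, hlint _ (hgm.ennreal_ofReal.lintegral_prod_right')]
    have hKeq : ∀ i, ∫⁻ x, (∫⁻ y, ENNReal.ofReal (v i (x, y) ^ 2 / g (x, y)) ∂ρ) =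
        ∫⁻ z : Fin n → ℝ, (∫⁻ t : ℝ, (∫⁻ y, ENNReal.ofReal
          (v i (Fin.cons t z, y) ^ 2 / g (Fin.cons t z, y)) ∂ρ)) := by
      intro i
      rw [hlint _ (Measurable.lintegral_prod_right'
        (f := fun a => ENNReal.ofReal (v i a ^ 2 / g a))
        (((hvm i).pow_const 2).div hgm).ennreal_ofReal)]
    have hgt : ∀ z y t, HasDerivAt (fun s => g (Fin.cons s z, y)) (v 0 (Fin.cons t z, y)) t := by
      intro z y t
      have := hd 0 (Fin.cons t z) y
      simpa only [Fin.update_cons_zero, Fin.cons_zero] using this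
    have hline : ∀ᵐ z : Fin n → ℝ, ∀ᵐ y ∂ρ,
        ∫⁻ t : ℝ, ENNReal.ofReal (g (Fin.cons t z, y)) ≠ ⊤ := by
      have hz : ∀ᵐ z : Fin n → ℝ, ∫⁻ t, p (t, z) < ⊤ :=
        ae_lt_top hpm.lintegral_prod_left' (by rw [hp1]; exact ENNReal.one_ne_top)
      filter_upwards [hz] with z hz
      have hm : Measurable fun a : ℝ × Y => ENNReal.ofReal (g (Fin.cons a.1 z, a.2)) :=
        (hgm.comp (hassoc.comp (f := fun a : ℝ × Y => ((a.1, z), a.2))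
          (by fun_prop))).ennreal_ofReal
      have hsw : ∫⁻ t, p (t, z) =
          ∫⁻ y, (∫⁻ t : ℝ, ENNReal.ofReal (g (Fin.cons t z, y))) ∂ρ :=
        lintegral_lintegral_swap (f := fun t y => ENNReal.ofReal (g (Fin.cons t z, y)))
          hm.aemeasurable
      rw [hsw] at hz
      filter_upwards [ae_lt_top hm.lintegral_prod_left' hz.ne] with y hy using hy.ne
    have hswap : ∀ (z : Fin n → ℝ) (s : Set ℝ),
        ∫⁻ y, (∫⁻ t in s, ENNReal.ofReal |v 0 (Fin.cons t z, y)|) ∂ρ =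
          ∫⁻ t in s, β (t, z) := by
      intro z s
      have hm : Measurable fun a : Y × ℝ => ENNReal.ofReal |v 0 (Fin.cons a.2 z, a.1)| :=
        ((hvm 0).comp (hassoc.comp (f := fun a : Y × ℝ => ((a.2, z), a.1))
          (by fun_prop))).abs.ennreal_ofReal
      exact lintegral_lintegral_swap
        (f := fun y t => ENNReal.ofReal |v 0 (Fin.cons t z, y)|) hm.aemeasurable
    have hvline : ∀ z y, Measurable fun t : ℝ => v 0 (Fin.cons t z, y) := fun z y =>
      (hvm 0).comp (hassoc.comp (f := fun t : ℝ => ((t, z), y)) (by fun_prop))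
    obtain ⟨w₁, hw₁m, hw₁i, hw₁le, hw₁int⟩ := exists_conditional_log_density_bound
      (volume : Measure (Fin n → ℝ)) (p := p) (β := β)
      (K := fun z => ∫⁻ y, ENNReal.ofReal
          (v 0 (Fin.cons z.1 z.2, y) ^ 2 / g (Fin.cons z.1 z.2, y)) ∂ρ)
      hpm hβm hp1 (by rw [← hKeq]; exact hfin 0)
      (by
        filter_upwards [hline] with z hz t
        rw [← hswap]
        refine lintegral_mono_ae ?_
        filter_upwards [hz] with y hy
        exact ofReal_le_setLIntegral_Ioi_deriv (hvline z y) (hgt z y) hy t)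
      (by
        filter_upwards [hline] with z hz t
        rw [← hswap]
        refine lintegral_mono_ae ?_
        filter_upwards [hz] with y hy
        exact ofReal_le_setLIntegral_Iio_deriv (hvline z y) (hgt z y) hy t)
      (by
        intro z r _
        have hgy : Measurable fun y => g (Fin.cons z.1 z.2, y) :=
          hgm.comp (hassoc.comp (f := fun y : Y => (z, y)) (by fun_prop))
        have hvy : Measurable fun y => v 0 (Fin.cons z.1 z.2, y) :=
          (hvm 0).comp (hassoc.comp (f := fun y : Y => (z, y)) (by fun_prop))
        -- Young's inequality is used for each `y` before integrating, so the full Fisher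
        -- information of `g` appears and not that of its marginal.
        have hle : ∫⁻ y, ENNReal.ofReal |v 0 (Fin.cons z.1 z.2, y)| * ENNReal.ofReal r ∂ρ ≤
            ∫⁻ y, (ENNReal.ofReal (v 0 (Fin.cons z.1 z.2, y) ^ 2 / g (Fin.cons z.1 z.2, y)) +
              ENNReal.ofReal (r ^ 2) * ENNReal.ofReal (g (Fin.cons z.1 z.2, y))) / 2 ∂ρ :=
          lintegral_mono fun y => ofReal_abs_mul_le (hg _) (hv0 0 _)
        simp_rw [div_eq_mul_inv] at hle ⊢
        rw [lintegral_mul_const' _ _ (by simp), lintegral_mul_const' _ _ (by simp),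
          lintegral_add_right _ (by fun_prop), lintegral_const_mul' _ _ (by simp)] at hle
        exact hle)
      (by
        intro z hz
        have hgy : Measurable fun y => g (Fin.cons z.1 z.2, y) :=
          hgm.comp (hassoc.comp (f := fun y : Y => (z, y)) (by fun_prop))
        have := (lintegral_eq_zero_iff hgy.ennreal_ofReal).1 hz
        refine lintegral_eq_zero_of_ae_eq_zero ?_
        filter_upwards [this] with y hy
        have hy' : g (Fin.cons z.1 z.2, y) = 0 :=
          le_antisymm (ENNReal.ofReal_eq_zero.1 hy) (hg _)
        simp [hv0 0 _ hy'])
    have hprod : ∀ φ : (Fin (n + 1) → ℝ) × Y → ℝ, Measurable φ → ∀ z : Fin n → ℝ,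
        ∫⁻ a : ℝ × Y, ENNReal.ofReal (φ (Fin.cons a.1 z, a.2)) ∂(volume.prod ρ) =
          ∫⁻ t : ℝ, (∫⁻ y, ENNReal.ofReal (φ (Fin.cons t z, y)) ∂ρ) := by
      intro φ hφ z
      rw [lintegral_prod]
      exact (hφ.comp (hassoc'.comp (f := fun a : ℝ × Y => (z, a))
        (by fun_prop))).ennreal_ofReal.aemeasurable
    -- The coordinate just treated joins the hidden variables: the new parameter space is `ℝ × Y`.
    obtain ⟨w₂, hw₂m, hw₂i, hw₂le, hw₂int⟩ := ih (volume.prod ρ)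
      (fun a => g (Fin.cons a.2.1 a.1, a.2.2)) (fun i a => v i.succ (Fin.cons a.2.1 a.1, a.2.2))
      (fun z => hg _) (hgm.comp hassoc') (fun i => (hvm _).comp hassoc')
      (fun i z a => by
        have := hd i.succ (Fin.cons a.1 z) a.2
        simpa only [← Fin.cons_update, Fin.cons_succ] using this)
      (by simp_rw [hprod g hgm]; exact hp1)
      (fun i => by
        simp_rw [hprod (fun a => v i.succ a ^ 2 / g a) (((hvm _).pow_const 2).div hgm)]
        rw [← hKeq]; exact hfin _)
    simp_rw [fun i : Fin n => hprod (fun a => v i.succ a ^ 2 / g a)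
      (((hvm _).pow_const 2).div hgm), ← hKeq] at hw₂int
    simp_rw [hprod g hgm] at hw₂i hw₂le hw₂int
    have hpe : ∀ x, ∫⁻ y, ENNReal.ofReal (g (x, y)) ∂ρ = p (e x) := by
      intro x
      have : (Fin.cons (e x).1 (e x).2 : Fin (n + 1) → ℝ) = x := by
        rw [← hes]; exact e.symm_apply_apply x
      rw [hp]
      simp only [this]
    simp_rw [hpe]
    obtain ⟨w, hwm, hwi, hwle, hwint⟩ := exists_log_bound_of_marginal e hep hpm hw₁m hw₁i hw₁le
      hw₂m hw₂i hw₂le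
    refine ⟨w, hwm, hwi, hwle, hwint.trans_le ?_⟩
    rw [Fin.sum_univ_succ]
    rw [← hKeq] at hw₁int
    push_cast
    linarith

end LogSobolev

/-! ### Calculus of integrals with values in `[-∞, ∞]`. -/

section ExtIntegral

variable {α : Type*} [MeasurableSpace α] {μ : Measure α}

theorem extIntegral_mono_ae {g h : α → ℝ} (hgh : g ≤ᵐ[μ] h) :
    extIntegral g μ ≤ extIntegral h μ := by
  refine EReal.sub_le_sub ?_ ?_ <;> refine EReal.coe_ennreal_le_coe_ennreal_iff.2 ?_ <;>
    refine lintegral_mono_ae ?_ <;> filter_upwards [hgh] with x hx <;>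
    exact ENNReal.ofReal_le_ofReal (by linarith)

theorem extIntegral_congr_ae {g h : α → ℝ} (hgh : g =ᵐ[μ] h) :
    extIntegral g μ = extIntegral h μ :=
  le_antisymm (extIntegral_mono_ae hgh.le) (extIntegral_mono_ae hgh.symm.le)

theorem quasiIntegrable_congr_ae {g h : α → ℝ} (hgh : g =ᵐ[μ] h) :
    QuasiIntegrable g μ ↔ QuasiIntegrable h μ := by
  unfold QuasiIntegrable
  rw [lintegral_congr_ae (g := fun x => ENNReal.ofReal (h x)),
    lintegral_congr_ae (f := fun x => ENNReal.ofReal (-g x)) (g := fun x => ENNReal.ofReal (-h x))]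
  · filter_upwards [hgh] with x hx; rw [hx]
  · filter_upwards [hgh] with x hx; rw [hx]

theorem MeasureTheory.Integrable.lintegral_ofReal_ne_top {w : α → ℝ} (hw : Integrable w μ) :
    ∫⁻ x, ENNReal.ofReal (w x) ∂μ ≠ ⊤ := by
  refine ne_top_of_le_ne_top hw.hasFiniteIntegral.ne (lintegral_mono fun x => ?_)
  rw [← ofReal_norm]
  exact ENNReal.ofReal_le_ofReal (le_abs_self _)

theorem extIntegral_eq_integral {w : α → ℝ} (hw : Integrable w μ) :
    extIntegral w μ = ((∫ x, w x ∂μ : ℝ) : EReal) := by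
  rw [extIntegral, integral_eq_lintegral_pos_part_sub_lintegral_neg_part hw, EReal.coe_sub,
    EReal.coe_ennreal_toReal hw.lintegral_ofReal_ne_top,
    EReal.coe_ennreal_toReal (by simpa using hw.neg.lintegral_ofReal_ne_top)]

theorem lintegral_ofReal_sub_le {w β : α → ℝ} (hw : AEMeasurable w μ) :
    ∫⁻ x, ENNReal.ofReal (w x - β x) ∂μ ≤
      (∫⁻ x, ENNReal.ofReal (w x) ∂μ) + ∫⁻ x, ENNReal.ofReal (-β x) ∂μ := by
  rw [← lintegral_add_left' hw.ennreal_ofReal]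
  exact lintegral_mono fun x => by rw [sub_eq_add_neg]; exact ENNReal.ofReal_add_le

theorem QuasiIntegrable.integrable_sub {w β : α → ℝ} (hw : Integrable w μ)
    (hβ : QuasiIntegrable β μ) : QuasiIntegrable (fun x => w x - β x) μ := by
  rcases hβ with h | h
  · refine Or.inr (ne_top_of_le_ne_top ?_ (lintegral_mono fun x => ENNReal.ofReal_le_ofReal
      (show -(w x - β x) ≤ -w x - -β x by linarith)))
    refine ne_top_of_le_ne_top ?_ (lintegral_ofReal_sub_le hw.neg.aemeasurable)
    simpa using ⟨hw.neg.lintegral_ofReal_ne_top, h⟩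
  · refine Or.inl (ne_top_of_le_ne_top ?_ (lintegral_ofReal_sub_le hw.aemeasurable))
    simpa using ⟨hw.lintegral_ofReal_ne_top, h⟩

/-- Linearity of the extended integral when one of the two functions is integrable. -/
theorem extIntegral_integrable_sub {w β : α → ℝ} (hw : Integrable w μ) (hβm : AEMeasurable β μ)
    (hβ : QuasiIntegrable β μ) :
    extIntegral (fun x => w x - β x) μ = ((∫ x, w x ∂μ : ℝ) : EReal) - extIntegral β μ := by
  have hwm := hw.aemeasurable
  have hW := hw.lintegral_ofReal_ne_top
  have hW' := hw.neg.lintegral_ofReal_ne_top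
  by_cases hp : ∫⁻ x, ENNReal.ofReal (β x) ∂μ = ⊤
  -- An infinite positive part of `β` makes both sides `-∞`; the next case, with an infinite
  -- negative part, makes both `+∞`.
  · have hn : ∫⁻ x, ENNReal.ofReal (-β x) ∂μ ≠ ⊤ := hβ.resolve_left (not_not.2 hp)
    have h1 : ∫⁻ x, ENNReal.ofReal (w x - β x) ∂μ ≠ ⊤ :=
      ne_top_of_le_ne_top (ENNReal.add_ne_top.2 ⟨hW, hn⟩) (lintegral_ofReal_sub_le hwm)
    have h2 : ∫⁻ x, ENNReal.ofReal (-(w x - β x)) ∂μ = ⊤ := by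
      by_contra h2
      have h3 := lintegral_ofReal_sub_le (w := w) (β := fun x => w x - β x) hwm
      simp only [sub_sub_cancel] at h3
      exact (ENNReal.add_ne_top.2 ⟨hW, h2⟩) (top_le_iff.1 (hp ▸ h3))
    rw [extIntegral, extIntegral, hp, h2, EReal.coe_ennreal_top, EReal.sub_top,
      EReal.top_sub (by simpa using hn)]
    rfl
  · by_cases hn : ∫⁻ x, ENNReal.ofReal (-β x) ∂μ = ⊤
    · have h1 : ∫⁻ x, ENNReal.ofReal (-(w x - β x)) ∂μ ≠ ⊤ := by
        have h3 := lintegral_ofReal_sub_le (w := fun x => -w x) (β := fun x => -β x) hwm.neg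
        refine ne_top_of_le_ne_top (ENNReal.add_ne_top.2 ⟨hW', ?_⟩)
          ((lintegral_congr fun x => by congr 1; ring).trans_le h3)
        simpa using hp
      have h2 : ∫⁻ x, ENNReal.ofReal (w x - β x) ∂μ = ⊤ := by
        by_contra h2
        have h3 := lintegral_ofReal_sub_le (w := fun x => -w x) (β := fun x => -(w x - β x))
          hwm.neg
        have h4 : ∀ x, -w x - -(w x - β x) = -β x := fun x => by ring
        simp only [h4, neg_neg] at h3
        exact (ENNReal.add_ne_top.2 ⟨hW', h2⟩) (top_le_iff.1 (hn ▸ h3))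
      rw [extIntegral, extIntegral, hn, h2, EReal.coe_ennreal_top, EReal.sub_top,
        EReal.top_sub (by simpa using h1)]
      rfl
    · have hβi : Integrable β μ := by
        refine ⟨hβm.aestronglyMeasurable, ?_⟩
        rw [hasFiniteIntegral_iff_norm]
        calc ∫⁻ x, ENNReal.ofReal ‖β x‖ ∂μ
            ≤ ∫⁻ x, (ENNReal.ofReal (β x) + ENNReal.ofReal (-β x)) ∂μ := by
              refine lintegral_mono fun x => ?_
              rcases le_total 0 (β x) with h | h
              · rw [Real.norm_of_nonneg h]; exact le_self_add
              · rw [Real.norm_of_nonpos h]; exact le_add_self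
          _ = (∫⁻ x, ENNReal.ofReal (β x) ∂μ) + ∫⁻ x, ENNReal.ofReal (-β x) ∂μ :=
              lintegral_add_left' hβm.ennreal_ofReal _
          _ < ⊤ := ENNReal.add_lt_top.2 ⟨lt_top_iff_ne_top.2 hp, lt_top_iff_ne_top.2 hn⟩
      have hsub : Integrable (fun x => w x - β x) μ := hw.sub hβi
      rw [extIntegral_eq_integral hsub,
        extIntegral_eq_integral hβi, integral_sub hw hβi, EReal.coe_sub]

end ExtIntegral

/-! ### Pullback of a density by a diffeomorphism, and the inequality in Euclidean space. -/

section ChangeOfVariables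

open Set

variable {n : ℕ}

theorem SmoothDiffeo.contDiff (T : SmoothDiffeo n) : ContDiff ℝ ∞ T :=
  T.contMDiff.contDiff

theorem SmoothDiffeo.hasFDerivAt (T : SmoothDiffeo n) (y : EuclideanSpace ℝ (Fin n)) :
    HasFDerivAt T (fderiv ℝ T y) y :=
  (T.contDiff.differentiable (by simp) y).hasFDerivAt

theorem SmoothDiffeo.measurable (T : SmoothDiffeo n) : Measurable T :=
  T.contDiff.continuous.measurable

theorem SmoothDiffeo.det_fderiv_ne_zero (T : SmoothDiffeo n) (y : EuclideanSpace ℝ (Fin n)) :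
    (fderiv ℝ T y).det ≠ 0 := by
  have h1 : HasFDerivAt (T.symm ∘ T) ((fderiv ℝ T.symm (T y)).comp (fderiv ℝ T y)) y :=
    (SmoothDiffeo.hasFDerivAt T.symm (T y)).comp y (T.hasFDerivAt y)
  have h2 : T.symm ∘ T = id := funext fun x => T.symm_apply_apply x
  rw [h2] at h1
  have h3 := h1.unique (hasFDerivAt_id y)
  have h4 := congrArg ContinuousLinearMap.det h3
  intro h0
  rw [ContinuousLinearMap.det, ContinuousLinearMap.toLinearMap_comp, LinearMap.det_comp] at h4
  rw [ContinuousLinearMap.det] at h0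
  rw [h0, mul_zero] at h4
  simp [ContinuousLinearMap.det] at h4

theorem differentiable_det_fderiv (T : SmoothDiffeo n) :
    Differentiable ℝ fun y => (fderiv ℝ T y).det := by
  have hD : Differentiable ℝ (fderiv ℝ T) :=
    (T.contDiff.fderiv_right (m := ∞) (by simp)).differentiable (by simp)
  have h : ∀ y, (fderiv ℝ T y).det =
      Matrix.det (Matrix.of fun i j => (fderiv ℝ T y (EuclideanSpace.single j 1)) i) := by
    intro y
    rw [ContinuousLinearMap.det,
      ← LinearMap.det_toMatrix (EuclideanSpace.basisFun (Fin n) ℝ).toBasis]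
    congr 1
  simp_rw [h, Matrix.det_apply]
  simp only [Matrix.of_apply]
  have h2 : ∀ i j, Differentiable ℝ fun y => (fderiv ℝ T y (EuclideanSpace.single j 1)) i := by
    intro i j
    have := (hD.clm_apply (differentiable_const (EuclideanSpace.single j (1 : ℝ))))
    exact (EuclideanSpace.proj i : (EuclideanSpace ℝ (Fin n)) →L[ℝ] ℝ).differentiable.comp this
  fun_prop

theorem differentiable_logAbsDet (T : SmoothDiffeo n) : Differentiable ℝ (logAbsDet T) := by
  have : logAbsDet T = fun y => Real.log (fderiv ℝ T y).det := by
    ext y; rw [logAbsDet, Real.log_abs]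
  rw [this]
  exact (differentiable_det_fderiv T).log T.det_fderiv_ne_zero

theorem exp_logAbsDet (T : SmoothDiffeo n) (y : EuclideanSpace ℝ (Fin n)) :
    Real.exp (logAbsDet T y) = |(fderiv ℝ T y).det| :=
  Real.exp_log (abs_pos.2 (T.det_fderiv_ne_zero y))

/-- The density of the image of `f dx` under `T⁻¹`. -/
noncomputable def pullbackDensity (f : EuclideanSpace ℝ (Fin n) → ℝ) (T : SmoothDiffeo n)
    (y : EuclideanSpace ℝ (Fin n)) : ℝ :=
  f (T y) * Real.exp (logAbsDet T y)

theorem map_symm_withDensity (T : SmoothDiffeo n) (f : EuclideanSpace ℝ (Fin n) → ℝ) :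
    Measure.map T.symm (volume.withDensity fun x => ENNReal.ofReal (f x)) =
      volume.withDensity fun y => ENNReal.ofReal (pullbackDensity f T y) := by
  ext s hs
  have himg : T.symm ⁻¹' s = T '' s := by
    ext x
    constructor
    · intro hx
      exact ⟨T.symm x, hx, T.apply_symm_apply x⟩
    · rintro ⟨y, hy, rfl⟩
      simpa using hy
  rw [Measure.map_apply (SmoothDiffeo.measurable T.symm) hs, himg,
    withDensity_apply _ (himg ▸ (SmoothDiffeo.measurable T.symm) hs), withDensity_apply _ hs,
    lintegral_image_eq_lintegral_abs_det_fderiv_mul volume hs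
      (fun y _ => (T.hasFDerivAt y).hasFDerivWithinAt) T.injective.injOn]
  refine lintegral_congr fun y => ?_
  rw [pullbackDensity, exp_logAbsDet, mul_comm (f (T y)), ENNReal.ofReal_mul (abs_nonneg _)]

theorem differentiable_pullbackDensity (T : SmoothDiffeo n) {f : EuclideanSpace ℝ (Fin n) → ℝ}
    (hf : Differentiable ℝ f) : Differentiable ℝ (pullbackDensity f T) :=
  (hf.comp fun y => (T.hasFDerivAt y).differentiableAt).mul (differentiable_logAbsDet T).exp

/-- Logarithmic differentiation of `f(T y) |det DT(y)|`: the score field, read at `T y`, is `∇ log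
g`. -/
theorem gradient_pullbackDensity (T : SmoothDiffeo n) {f : EuclideanSpace ℝ (Fin n) → ℝ}
    (hf : Differentiable ℝ f) {y : EuclideanSpace ℝ (Fin n)} (hy : f (T y) ≠ 0) :
    gradient (pullbackDensity f T) y = pullbackDensity f T y • scoreField f T (T y) := by
  refine HasGradientAt.gradient ?_
  rw [hasGradientAt_iff_hasFDerivAt]
  have h1 : HasFDerivAt (fun y => f (T y)) ((fderiv ℝ f (T y)).comp (fderiv ℝ T y)) y :=
    (hf (T y)).hasFDerivAt.comp y (T.hasFDerivAt y)
  have h2 := (differentiable_logAbsDet T y).hasFDerivAt.exp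
  refine (h1.mul h2).congr_fderiv ?_
  ext z
  have hsy : T.symm (T y) = y := T.symm_apply_apply y
  simp only [scoreField, pullbackDensity, hsy, InnerProductSpace.toDual_apply_apply,
    inner_smul_left, inner_add_left, ContinuousLinearMap.adjoint_inner_left,
    add_apply, smul_apply,
    ContinuousLinearMap.comp_apply, ← toDual_gradient, smul_eq_mul, conj_trivial]
  field_simp
  ring

theorem measurable_gradient (f : EuclideanSpace ℝ (Fin n) → ℝ) : Measurable (gradient f) :=
  ((InnerProductSpace.toDual ℝ (EuclideanSpace ℝ (Fin n))).symm.continuous.measurable).comp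
    (measurable_fderiv ℝ f)

/-- The Euclidean logarithmic Sobolev inequality, in the form of a pointwise bound of the
log-density by a function with controlled integral. -/
theorem exists_log_density_bound_of_fisher {g : EuclideanSpace ℝ (Fin n) → ℝ} (hg : ∀ x, 0 ≤ g x)
    (hgd : Differentiable ℝ g) (hg1 : ∫⁻ x, ENNReal.ofReal (g x) = 1)
    (hfin : ∫⁻ x, ENNReal.ofReal (‖gradient g x‖ ^ 2 / g x) ≠ ⊤) :
    ∃ w : EuclideanSpace ℝ (Fin n) → ℝ,
      Integrable w (volume.withDensity fun x => ENNReal.ofReal (g x)) ∧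
      (∀ᵐ x ∂(volume.withDensity fun x => ENNReal.ofReal (g x)), Real.log (g x) ≤ w x) ∧
      ∫ x, w x ∂(volume.withDensity fun x => ENNReal.ofReal (g x)) ≤
        (∫⁻ x, ENNReal.ofReal (‖gradient g x‖ ^ 2 / g x)).toReal / 2
          - n * (Real.log (2 * Real.pi) / 2 + 1) := by
  have hto := PiLp.volume_preserving_toLp (Fin n)
  have hof := PiLp.volume_preserving_ofLp (Fin n)
  have hgm : Measurable g := hgd.continuous.measurable
  have hGm := measurable_gradient g
  have hcoord : ∀ i, Measurable fun x => gradient g x i := fun i =>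
    (EuclideanSpace.proj i : (EuclideanSpace ℝ (Fin n)) →L[ℝ] ℝ).continuous.measurable.comp hGm
  have hsum : ∫⁻ x, ENNReal.ofReal (‖gradient g x‖ ^ 2 / g x) =
      ∑ i, ∫⁻ x, ENNReal.ofReal ((gradient g x i) ^ 2 / g x) := by
    rw [← lintegral_finsetSum (f := fun i x => ENNReal.ofReal ((gradient g x i) ^ 2 / g x)) _
      fun i _ => (((hcoord i).pow_const 2).div hgm).ennreal_ofReal]
    refine lintegral_congr fun x => ?_
    rw [← ENNReal.ofReal_sum_of_nonneg fun i _ => div_nonneg (sq_nonneg _) (hg x),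
      EuclideanSpace.real_norm_sq_eq, Finset.sum_div]
  have hpi : ∀ φ : (EuclideanSpace ℝ (Fin n)) → ENNReal, Measurable φ →
      ∫⁻ x : Fin n → ℝ, φ (WithLp.toLp 2 x) = ∫⁻ x, φ x := fun φ hφ => hto.lintegral_comp hφ
  have htom : Measurable fun z : (Fin n → ℝ) × Unit =>
      (WithLp.toLp 2 z.1 : EuclideanSpace ℝ (Fin n)) :=
    hto.measurable.comp measurable_fst
  obtain ⟨w, hwm, hwi, hwle, hwint⟩ := exists_log_density_bound n (Y := Unit)
    (Measure.dirac ()) (fun z => g (WithLp.toLp 2 z.1))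
    (fun i z => gradient g (WithLp.toLp 2 z.1) i) (fun z => hg _) (hgm.comp htom)
    (fun i => (hcoord i).comp htom)
    (fun i x y => by
      have h1 : HasDerivAt
          (fun s => (WithLp.toLp 2 (Function.update x i s) : EuclideanSpace ℝ (Fin n)))
          (EuclideanSpace.single i 1) (x i) := by
        have h := (hasDerivAt_update x i (x i))
        exact ((PiLp.continuousLinearEquiv 2 ℝ (fun _ : Fin n => ℝ)).symm.hasFDerivAt
          (x := Function.update x i (x i))).comp_hasDerivAt (x i) h
      have h2 := (hgd (WithLp.toLp 2 x)).hasFDerivAt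
      rw [← Function.update_eq_self i x] at h2
      have h3 := h2.comp_hasDerivAt (x i) h1
      rw [Function.update_eq_self, ← toDual_gradient, InnerProductSpace.toDual_apply_apply,
        EuclideanSpace.inner_single_right] at h3
      simpa [Function.comp_def] using h3)
    (by
      simp only [lintegral_dirac]
      rw [hpi (fun x => ENNReal.ofReal (g x)) hgm.ennreal_ofReal, hg1])
    (fun i => by
      simp only [lintegral_dirac]
      rw [hpi (fun x => ENNReal.ofReal (gradient g x i ^ 2 / g x))
        (((hcoord i).pow_const 2).div hgm).ennreal_ofReal]
      rw [hsum] at hfin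
      exact ne_top_of_le_ne_top hfin (Finset.single_le_sum
        (f := fun i => ∫⁻ x, ENNReal.ofReal (gradient g x i ^ 2 / g x))
        (fun _ _ => zero_le) (Finset.mem_univ i)))
  simp only [lintegral_dirac] at hwi hwle hwint
  have hpres : MeasurePreserving (WithLp.ofLp : (EuclideanSpace ℝ (Fin n)) → (Fin n → ℝ))
      (volume.withDensity fun x => ENNReal.ofReal (g x))
      (volume.withDensity fun x => ENNReal.ofReal (g (WithLp.toLp 2 x))) :=
    hof.withDensity_comp (p := fun x => ENNReal.ofReal (g (WithLp.toLp 2 x)))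
      (hgm.comp hto.measurable).ennreal_ofReal
  refine ⟨fun x => w (WithLp.ofLp x), hpres.integrable_comp_of_integrable (g := w) hwi, ?_, ?_⟩
  · have := hpres.quasiMeasurePreserving.ae hwle
    filter_upwards [this] with x hx
    simpa [ENNReal.toReal_ofReal (hg x)] using hx
  · have h1 : ∫ x, w (WithLp.ofLp x) ∂(volume.withDensity fun x => ENNReal.ofReal (g x)) =
        ∫ x, w x ∂(volume.withDensity fun x => ENNReal.ofReal (g (WithLp.toLp 2 x))) := by
      rw [← hpres.map_eq, integral_map hpres.measurable.aemeasurable hwm.aestronglyMeasurable]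
    rw [h1]
    refine hwint.trans_eq ?_
    rw [hsum, ENNReal.toReal_sum]
    · congr 2
      refine Finset.sum_congr rfl fun i _ => ?_
      rw [hpi (fun x => ENNReal.ofReal (gradient g x i ^ 2 / g x))
        (((hcoord i).pow_const 2).div hgm).ennreal_ofReal]
    · intro i _
      rw [hsum] at hfin
      exact ne_top_of_le_ne_top hfin (Finset.single_le_sum
        (f := fun i => ∫⁻ x, ENNReal.ofReal (gradient g x i ^ 2 / g x))
        (fun _ _ => zero_le) (Finset.mem_univ i))

end ChangeOfVariables

/-! ### Density, second moment and logarithm of the standard Gaussian measure. -/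

section GaussianDensity

open Set

/-- The density of the standard Gaussian measure of `ℝⁿ`. -/
noncomputable def stdGaussianDensity (n : ℕ) (x : EuclideanSpace ℝ (Fin n)) : ℝ :=
  Real.exp (-(‖x‖ ^ 2 / 2) - n * (Real.log (2 * Real.pi) / 2))

theorem stdGaussianDensity_eq_prod (n : ℕ) (x : EuclideanSpace ℝ (Fin n)) :
    stdGaussianDensity n x = ∏ i, gaussianPDFReal 0 1 (x i) := by
  have h : ∀ t : ℝ, gaussianPDFReal 0 1 t =
      Real.exp (-(t ^ 2 / 2) - Real.log (2 * Real.pi) / 2) := by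
    intro t
    rw [gaussianPDFReal_def, ← Real.log_sqrt (by positivity), Real.exp_sub,
      Real.exp_log (by positivity), div_eq_inv_mul]
    simp [neg_div]
  simp_rw [h]
  rw [← Real.exp_sum, stdGaussianDensity, EuclideanSpace.real_norm_sq_eq, Finset.sum_sub_distrib,
    Finset.sum_neg_distrib, Finset.sum_div]
  simp

theorem pi_gaussianReal_eq_withDensity (n : ℕ) :
    Measure.pi (fun _ : Fin n => gaussianReal 0 1) =
      volume.withDensity fun x => ENNReal.ofReal (∏ i, gaussianPDFReal 0 1 (x i)) := by
  refine Measure.pi_eq fun s hs => ?_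
  have hint : Integrable (fun x : Fin n → ℝ => ∏ i, gaussianPDFReal 0 1 (x i))
      (Measure.pi fun i => (volume : Measure ℝ).restrict (s i)) :=
    Integrable.fintype_prod fun i => (integrable_gaussianPDFReal 0 1).restrict
  rw [withDensity_apply _ (MeasurableSet.univ_pi hs), volume_pi, Measure.restrict_pi_pi,
    ← ofReal_integral_eq_lintegral_ofReal hint (ae_of_all _ fun x =>
      Finset.prod_nonneg fun i _ => gaussianPDFReal_nonneg _ _ _),
    integral_fintype_prod_eq_prod (μ := fun i => (volume : Measure ℝ).restrict (s i))
      (fun _ => gaussianPDFReal 0 1),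
    ENNReal.ofReal_prod_of_nonneg fun i _ =>
      integral_nonneg fun x => gaussianPDFReal_nonneg _ _ _]
  exact Finset.prod_congr rfl fun i _ => (gaussianReal_apply_eq_integral 0 one_ne_zero _).symm

theorem continuous_stdGaussianDensity (n : ℕ) : Continuous (stdGaussianDensity n) := by
  unfold stdGaussianDensity; fun_prop

theorem stdGaussian_eq_withDensity (n : ℕ) :
    stdGaussian (EuclideanSpace ℝ (Fin n)) =
      volume.withDensity fun x => ENNReal.ofReal (stdGaussianDensity n x) := by
  have hm : Measurable fun x => ENNReal.ofReal (stdGaussianDensity n x) :=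
    (continuous_stdGaussianDensity n).measurable.ennreal_ofReal
  rw [← map_pi_eq_stdGaussian, pi_gaussianReal_eq_withDensity,
    ← ((PiLp.volume_preserving_toLp (Fin n)).withDensity_comp hm).map_eq]
  simp_rw [stdGaussianDensity_eq_prod]

theorem integrable_norm_sq_stdGaussian (n : ℕ) :
    Integrable (fun x => ‖x‖ ^ 2) (stdGaussian (EuclideanSpace ℝ (Fin n))) :=
  (IsGaussian.memLp_two_id (μ := stdGaussian (EuclideanSpace ℝ (Fin n)))).integrable_norm_pow
    two_ne_zero

theorem integral_norm_sq_stdGaussian (n : ℕ) :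
    ∫ x, ‖x‖ ^ 2 ∂(stdGaussian (EuclideanSpace ℝ (Fin n))) = n := by
  have hsq : Integrable (fun x : ℝ => x ^ 2) (gaussianReal 0 1) :=
    (memLp_id_gaussianReal (μ := 0) (v := 1) 2).integrable_sq
  have h2 : ∫ x, x ^ 2 ∂(gaussianReal 0 1) = 1 := by
    have h := variance_fun_id_gaussianReal (μ := 0) (v := 1)
    rw [variance_eq_integral measurable_id'.aemeasurable] at h
    simpa using h
  rw [← map_pi_eq_stdGaussian, integral_map (by fun_prop) (by fun_prop)]
  simp_rw [EuclideanSpace.real_norm_sq_eq]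
  rw [integral_finsetSum _ fun i _ =>
    integrable_comp_eval (μ := fun _ : Fin n => gaussianReal 0 1) (i := i)
      (f := fun t : ℝ => t ^ 2) hsq]
  have : ∀ i : Fin n, ∫ x : Fin n → ℝ, x i ^ 2 ∂(Measure.pi fun _ => gaussianReal 0 1) = 1 :=
    fun i => (integral_comp_eval (μ := fun _ : Fin n => gaussianReal 0 1) (i := i)
      (f := fun t : ℝ => t ^ 2) hsq.aestronglyMeasurable).trans h2
  simp [this]

theorem log_stdGaussianDensity (n : ℕ) (x : EuclideanSpace ℝ (Fin n)) :
    Real.log (stdGaussianDensity n x) = -(‖x‖ ^ 2 / 2) - n * (Real.log (2 * Real.pi) / 2) :=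
  Real.log_exp _

theorem integrable_log_stdGaussianDensity (n : ℕ) :
    Integrable (fun x => Real.log (stdGaussianDensity n x))
      (stdGaussian (EuclideanSpace ℝ (Fin n))) := by
  simp_rw [log_stdGaussianDensity]
  exact (((integrable_norm_sq_stdGaussian n).div_const 2).neg).sub (integrable_const _)

theorem integral_log_stdGaussianDensity (n : ℕ) :
    ∫ x, Real.log (stdGaussianDensity n x) ∂(stdGaussian (EuclideanSpace ℝ (Fin n))) =
      -(n / 2) - n * (Real.log (2 * Real.pi) / 2) := by
  simp_rw [log_stdGaussianDensity]
  have hi : Integrable (fun x => -(‖x‖ ^ 2 / 2)) (stdGaussian (EuclideanSpace ℝ (Fin n))) :=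
    ((integrable_norm_sq_stdGaussian n).div_const 2).neg
  rw [integral_sub hi (integrable_const _), integral_neg, integral_div,
    integral_norm_sq_stdGaussian]
  simp

theorem gradient_stdGaussianDensity (n : ℕ) (x : EuclideanSpace ℝ (Fin n)) :
    gradient (stdGaussianDensity n) x = -stdGaussianDensity n x • x := by
  refine HasGradientAt.gradient ?_
  rw [hasGradientAt_iff_hasFDerivAt]
  have h1 : HasFDerivAt (fun y : EuclideanSpace ℝ (Fin n) => ‖y‖ ^ 2) (2 • innerSL ℝ x) x :=
    (hasStrictFDerivAt_norm_sq x).hasFDerivAt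
  have h2 := (((h1.mul_const (2 : ℝ)⁻¹).neg).sub_const (n * (Real.log (2 * Real.pi) / 2))).exp
  refine h2.congr_fderiv ?_
  ext z
  simp [stdGaussianDensity, div_eq_mul_inv]

end GaussianDensity

/-! ### The inequality and its equality case. -/

section Entropy

theorem llr_withDensity_ofReal {α : Type*} [MeasurableSpace α] {μ ρ : Measure α} [SigmaFinite ρ]
    {f : α → ℝ} (hf : ∀ x, 0 ≤ f x) (hfm : Measurable f)
    (hμ : μ = ρ.withDensity fun x => ENNReal.ofReal (f x)) :
    llr μ ρ =ᵐ[μ] fun x => Real.log (f x) := by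
  have hac : μ ≪ ρ := hμ ▸ withDensity_absolutelyContinuous _ _
  have h := Measure.rnDeriv_withDensity ρ hfm.ennreal_ofReal
  rw [← hμ] at h
  filter_upwards [hac.ae_le h] with x hx
  rw [llr_def]
  simp only [hx, ENNReal.toReal_ofReal (hf x)]

theorem ae_withDensity_ofReal_pos {α : Type*} [MeasurableSpace α] {ρ : Measure α}
    {f : α → ℝ} (hfm : Measurable f) :
    ∀ᵐ x ∂(ρ.withDensity fun x => ENNReal.ofReal (f x)), 0 < f x := by
  rw [ae_withDensity_iff hfm.ennreal_ofReal]
  exact ae_of_all _ fun x hx => by simpa using hx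

theorem relEntropy_stdGaussian (n : ℕ) :
    relEntropy (stdGaussian (EuclideanSpace ℝ (Fin n))) volume =
      ((-(n / 2) - n * (Real.log (2 * Real.pi) / 2) : ℝ) : EReal) := by
  rw [relEntropy, extIntegral_congr_ae (llr_withDensity_ofReal
      (f := stdGaussianDensity n) (fun x => (Real.exp_pos _).le)
      (continuous_stdGaussianDensity n).measurable (stdGaussian_eq_withDensity n)),
    extIntegral_eq_integral (integrable_log_stdGaussianDensity n),
    integral_log_stdGaussianDensity]

/-- Here `b` is the integral of the log-determinant, which may be infinite. For `b = ⊤` the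
hypothesis forces `a = ⊥`; for `b = ⊥` the right side is `⊤`. -/
theorem EReal.sub_coe_le_coe_sub {a b : EReal} {r s h : ℝ} (hab : a ≤ r - b) (hr : r - h ≤ s) :
    a - h ≤ s - b := by
  induction b with
  | bot => simp
  | top => simp_all
  | coe b =>
    refine (EReal.sub_le_sub hab (le_refl (h : EReal))).trans ?_
    norm_cast
    linarith

variable {n : ℕ} {μ : Measure (EuclideanSpace ℝ (Fin n))} {f : EuclideanSpace ℝ (Fin n) → ℝ}

/-- Changing variables by `T⁻¹` turns `∫ |∇ log g|² g` into the Fisher information of `g`. -/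
theorem scoreEnergy_eq_lintegral_pullbackDensity (hf_nonneg : ∀ x, 0 ≤ f x)
    (hf_diff : Differentiable ℝ f)
    (hμ : μ = volume.withDensity fun x => ENNReal.ofReal (f x)) (T : SmoothDiffeo n) :
    scoreEnergy μ f T = ∫⁻ y, ENNReal.ofReal
      (‖gradient (pullbackDensity f T) y‖ ^ 2 / pullbackDensity f T y) := by
  set g := pullbackDensity f T with hg
  have hgm : Measurable g := (differentiable_pullbackDensity T hf_diff).continuous.measurable
  have hg0 : ∀ y, 0 ≤ g y := fun y => mul_nonneg (hf_nonneg _) (Real.exp_pos _).le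
  have hν : Measure.map T.symm μ = volume.withDensity fun y => ENNReal.ofReal (g y) := by
    rw [hμ, map_symm_withDensity]
  have hemb : MeasurableEmbedding T.symm := T.symm.toHomeomorph.measurableEmbedding
  have h1 : scoreEnergy μ f T =
      ∫⁻ y, ENNReal.ofReal (‖scoreField f T (T y)‖ ^ 2) ∂(Measure.map T.symm μ) := by
    rw [hemb.lintegral_map]
    simp only [T.apply_symm_apply, scoreEnergy]
  have h2 : ∫⁻ y, ENNReal.ofReal (‖scoreField f T (T y)‖ ^ 2) ∂(Measure.map T.symm μ) =
      ∫⁻ y, ENNReal.ofReal (‖gradient g y‖ ^ 2 / g y ^ 2) ∂(Measure.map T.symm μ) := by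
    rw [hν]
    refine lintegral_congr_ae ?_
    filter_upwards [ae_withDensity_ofReal_pos hgm] with y hy
    have hfy : f (T y) ≠ 0 := fun h => hy.ne' (by rw [hg, pullbackDensity, h, zero_mul])
    rw [hg, gradient_pullbackDensity T hf_diff hfy, ← hg, norm_smul, Real.norm_of_nonneg (hg0 y),
      mul_pow, mul_div_cancel_left₀ _ (pow_ne_zero 2 hy.ne')]
  have hGm : Measurable (gradient g) := measurable_gradient g
  rw [h1, h2, hν, lintegral_withDensity_eq_lintegral_mul _ hgm.ennreal_ofReal (by fun_prop)]
  refine lintegral_congr fun y => ?_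
  rw [Pi.mul_apply, ← ENNReal.ofReal_mul (hg0 y)]
  congr 1
  -- At zeros of `g` both sides vanish because division by zero gives zero.
  rcases eq_or_ne (g y) 0 with h | h
  · simp [h]
  · field_simp

theorem log_pullbackDensity {T : SmoothDiffeo n} {x : EuclideanSpace ℝ (Fin n)} (hx : 0 < f x) :
    Real.log (pullbackDensity f T (T.symm x)) = Real.log (f x) + logAbsDet T (T.symm x) := by
  rw [pullbackDensity, T.apply_symm_apply, Real.log_mul hx.ne' (Real.exp_pos _).ne', Real.log_exp]

theorem relEntropy_sub_le_psiFunctional [IsProbabilityMeasure μ] (hf_nonneg : ∀ x, 0 ≤ f x)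
    (hf_diff : Differentiable ℝ f)
    (hμ : μ = volume.withDensity fun x => ENNReal.ofReal (f x)) (T : SmoothDiffeo n) :
    relEntropy μ volume - relEntropy (stdGaussian (EuclideanSpace ℝ (Fin n))) volume
      ≤ psiFunctional μ f T := by
  have hfm : Measurable f := hf_diff.continuous.measurable
  have hTm : Measurable T.symm := SmoothDiffeo.measurable T.symm
  rw [psiFunctional]
  split_ifs with hcase
  · exact le_top
  push Not at hcase
  obtain ⟨hfin, hQ⟩ := hcase
  set g := pullbackDensity f T with hg
  have hg0 : ∀ y, 0 ≤ g y := fun y => mul_nonneg (hf_nonneg _) (Real.exp_pos _).le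
  have hν : Measure.map T.symm μ = volume.withDensity fun y => ENNReal.ofReal (g y) := by
    rw [hμ, map_symm_withDensity]
  have hen := scoreEnergy_eq_lintegral_pullbackDensity hf_nonneg hf_diff hμ T
  have hprob : IsProbabilityMeasure (Measure.map T.symm μ) :=
    Measure.isProbabilityMeasure_map hTm.aemeasurable
  have hg1 : ∫⁻ y, ENNReal.ofReal (g y) = 1 := by
    have := measure_univ (μ := Measure.map T.symm μ)
    rwa [hν, withDensity_apply _ MeasurableSet.univ, setLIntegral_univ] at this
  obtain ⟨w, hwi, hwle, hwint⟩ := exists_log_density_bound_of_fisher hg0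
    (differentiable_pullbackDensity T hf_diff) hg1 (hen ▸ hfin)
  rw [← hν] at hwi hwle hwint
  rw [← hen] at hwint
  have hWi : Integrable (fun x => w (T.symm x)) μ := hwi.comp_measurable hTm
  have hW : ∫ x, w (T.symm x) ∂μ = ∫ y, w y ∂(Measure.map T.symm μ) :=
    (integral_map hTm.aemeasurable hwi.aestronglyMeasurable).symm
  have hle : (fun x => Real.log (f x)) ≤ᵐ[μ]
      fun x => w (T.symm x) - logAbsDet T (T.symm x) := by
    have hpos : ∀ᵐ x ∂μ, 0 < f x := hμ ▸ ae_withDensity_ofReal_pos hfm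
    filter_upwards [ae_of_ae_map hTm.aemeasurable hwle, hpos] with x hx hx0
    rw [hg, log_pullbackDensity hx0] at hx
    linarith
  have hβm : AEMeasurable (fun x => logAbsDet T (T.symm x)) μ :=
    ((differentiable_logAbsDet T).continuous.measurable.comp hTm).aemeasurable
  have h1 := extIntegral_mono_ae hle
  rw [extIntegral_integrable_sub hWi hβm hQ] at h1
  rw [relEntropy, extIntegral_congr_ae (llr_withDensity_ofReal hf_nonneg hfm hμ),
    relEntropy_stdGaussian]
  refine EReal.sub_coe_le_coe_sub h1 ?_
  rw [hW]
  linarith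

theorem psiFunctional_eq_of_map_eq_stdGaussian
    (hf_nonneg : ∀ x, 0 ≤ f x) (hf_diff : Differentiable ℝ f)
    (hμ : μ = volume.withDensity fun x => ENNReal.ofReal (f x))
    (hH : QuasiIntegrable (llr μ volume) μ) (T : SmoothDiffeo n)
    (hT : Measure.map T.symm μ = stdGaussian (EuclideanSpace ℝ (Fin n))) :
    psiFunctional μ f T =
      relEntropy μ volume - relEntropy (stdGaussian (EuclideanSpace ℝ (Fin n))) volume := by
  have hfm : Measurable f := hf_diff.continuous.measurable
  have hTm : Measurable T.symm := SmoothDiffeo.measurable T.symm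
  have hgc : Continuous (pullbackDensity f T) :=
    (differentiable_pullbackDensity T hf_diff).continuous
  have hν : Measure.map T.symm μ =
      volume.withDensity fun y => ENNReal.ofReal (pullbackDensity f T y) := by
    rw [hμ, map_symm_withDensity]
  -- Equal measures give almost everywhere equal densities; continuity makes them equal everywhere,
  -- so their gradients also agree.
  have hg : pullbackDensity f T = stdGaussianDensity n := by
    rw [hν, stdGaussian_eq_withDensity, withDensity_eq_iff_of_sigmaFinite
      hgc.measurable.ennreal_ofReal.aemeasurable
      (continuous_stdGaussianDensity n).measurable.ennreal_ofReal.aemeasurable] at hT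
    have hT' := (Continuous.ae_eq_iff_eq volume (ENNReal.continuous_ofReal.comp hgc)
      (ENNReal.continuous_ofReal.comp (continuous_stdGaussianDensity n))).1 hT
    ext y
    exact (ENNReal.ofReal_eq_ofReal_iff (mul_nonneg (hf_nonneg _) (Real.exp_pos _).le)
      (Real.exp_pos _).le).1 (congrFun hT' y)
  have hen : scoreEnergy μ f T = ENNReal.ofReal n := by
    rw [scoreEnergy_eq_lintegral_pullbackDensity hf_nonneg hf_diff hμ, hg]
    have h1 : ∀ y, ENNReal.ofReal (‖gradient (stdGaussianDensity n) y‖ ^ 2 /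
        stdGaussianDensity n y) = ENNReal.ofReal (stdGaussianDensity n y) *
          ENNReal.ofReal (‖y‖ ^ 2) := by
      intro y
      have hpos : 0 < stdGaussianDensity n y := Real.exp_pos _
      rw [← ENNReal.ofReal_mul hpos.le, gradient_stdGaussianDensity, norm_smul, norm_neg,
        Real.norm_of_nonneg hpos.le]
      congr 1
      field_simp
    have h2 := lintegral_withDensity_eq_lintegral_mul (volume : Measure (EuclideanSpace ℝ (Fin n)))
      (continuous_stdGaussianDensity n).measurable.ennreal_ofReal
      (g := fun y => ENNReal.ofReal (‖y‖ ^ 2)) (by fun_prop)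
    rw [← stdGaussian_eq_withDensity, ← ofReal_integral_eq_lintegral_ofReal
      (integrable_norm_sq_stdGaussian n) (ae_of_all _ fun y => sq_nonneg _),
      integral_norm_sq_stdGaussian] at h2
    simp_rw [h1]
    exact h2.symm
  set W := fun x => Real.log (stdGaussianDensity n (T.symm x)) with hWdef
  have hlogi := integrable_log_stdGaussianDensity n
  rw [← hT] at hlogi
  have hWi : Integrable W μ := hlogi.comp_measurable hTm
  have hW : ∫ x, W x ∂μ = -(n / 2) - n * (Real.log (2 * Real.pi) / 2) := by
    rw [← integral_log_stdGaussianDensity, ← hT, integral_map hTm.aemeasurable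
      hlogi.aestronglyMeasurable]
  have hpos : ∀ᵐ x ∂μ, 0 < f x := hμ ▸ ae_withDensity_ofReal_pos hfm
  have hllr := llr_withDensity_ofReal hf_nonneg hfm hμ
  have hβ : (fun x => logAbsDet T (T.symm x)) =ᵐ[μ] fun x => W x - llr μ volume x := by
    filter_upwards [hpos, hllr] with x hx hx2
    have := log_pullbackDensity (T := T) hx
    rw [hg] at this
    rw [hx2, hWdef]
    simp only [this]
    ring
  have hα : llr μ volume =ᵐ[μ] fun x => W x - logAbsDet T (T.symm x) := by
    filter_upwards [hβ] with x hx
    linarith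
  -- The log-determinant differs from `-log f` by the integrable `W`, so the assumption on the
  -- entropy of `μ` is what makes `ψ(T)` well defined.
  have hQ : QuasiIntegrable (fun x => logAbsDet T (T.symm x)) μ :=
    (quasiIntegrable_congr_ae hβ).2 (hH.integrable_sub hWi)
  have hβm : AEMeasurable (fun x => logAbsDet T (T.symm x)) μ :=
    ((differentiable_logAbsDet T).continuous.measurable.comp hTm).aemeasurable
  rw [psiFunctional, if_neg (by simp [hen, hQ]), hen, relEntropy_stdGaussian, relEntropy,
    extIntegral_congr_ae hα, extIntegral_integrable_sub hWi hβm hQ, hW,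
    ENNReal.toReal_ofReal n.cast_nonneg, sub_self, zero_div]
  generalize extIntegral (fun x => logAbsDet T (T.symm x)) μ = b
  generalize (-(n / 2) - n * (Real.log (2 * Real.pi) / 2) : ℝ) = r
  induction b with
  | bot => rw [EReal.coe_sub_bot, EReal.coe_sub_bot, EReal.top_sub_coe]
  | top => simp
  | coe b => norm_cast; ring

end Entropy

/-! ### Smooth dependence of integrals on parameters. -/

section ParametricIntegral

open Set

variable {P : Type} [NormedAddCommGroup P] [NormedSpace ℝ P]

theorem norm_iteratedFDeriv_left_le {V : Type} [NormedAddCommGroup V] [NormedSpace ℝ V]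
    {u : P × ℝ → V} (hu : ContDiff ℝ ∞ u) (k : ℕ) (z : P) (t : ℝ) :
    ‖iteratedFDeriv ℝ k (fun z => u (z, t)) z‖ ≤ ‖iteratedFDeriv ℝ k u (z, t)‖ := by
  have h1 : (fun z => u (z, t)) = (fun y => u (y + (0, t))) ∘ ContinuousLinearMap.inl ℝ P ℝ := by
    ext z; simp
  have hu' : ContDiff ℝ ∞ fun y => u (y + (0, t)) := hu.comp (contDiff_id.add contDiff_const)
  rw [h1, ContinuousLinearMap.iteratedFDeriv_comp_right _ hu' z (by exact_mod_cast le_top),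
    iteratedFDeriv_comp_add_right]
  refine (ContinuousMultilinearMap.norm_compContinuousLinearMap_le _ _).trans ?_
  have h2 : ‖ContinuousLinearMap.inl ℝ P ℝ‖ ≤ 1 := ContinuousLinearMap.norm_inl_le_one ℝ P ℝ
  have h3 : ∏ _i : Fin k, ‖ContinuousLinearMap.inl ℝ P ℝ‖ ≤ 1 :=
    Finset.prod_le_one (fun _ _ => norm_nonneg _) fun _ _ => h2
  refine (mul_le_of_le_one_right (norm_nonneg _) h3).trans (le_of_eq ?_)
  simp

/-- The hypotheses pass to the derivative of the integrand, with `k` shifted by one. The target `V`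
varies in the induction since the derivative is operator-valued. -/
theorem contDiff_nat_integral_of_dominated (ν : Measure ℝ) (n : ℕ) :
    ∀ {V : Type} [NormedAddCommGroup V] [NormedSpace ℝ V] [CompleteSpace V] {u : P × ℝ → V},
    ContDiff ℝ ∞ u →
    (∀ (k : ℕ) (R : ℝ), ∃ b : ℝ → ℝ, Integrable b ν ∧
      ∀ᵐ t ∂ν, ∀ z, ‖z‖ ≤ R → ‖iteratedFDeriv ℝ k (fun z => u (z, t)) z‖ ≤ b t) →
    ContDiff ℝ n fun z => ∫ t, u (z, t) ∂ν := by
  have hder : ∀ {V : Type} [NormedAddCommGroup V] [NormedSpace ℝ V] [CompleteSpace V]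
      {u : P × ℝ → V}, ContDiff ℝ ∞ u →
      (∀ (k : ℕ) (R : ℝ), ∃ b : ℝ → ℝ, Integrable b ν ∧
        ∀ᵐ t ∂ν, ∀ z, ‖z‖ ≤ R → ‖iteratedFDeriv ℝ k (fun z => u (z, t)) z‖ ≤ b t) →
      ∀ z, HasFDerivAt (fun z => ∫ t, u (z, t) ∂ν)
        (∫ t, fderiv ℝ (fun z => u (z, t)) z ∂ν) z := by
    intro V _ _ _ u hu hb z₀
    obtain ⟨b₀, hb₀, hb₀'⟩ := hb 0 ‖z₀‖
    obtain ⟨b₁, hb₁, hb₁'⟩ := hb 1 (‖z₀‖ + 1)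
    have hut : ∀ t, ContDiff ℝ ∞ fun z => u (z, t) := fun t =>
      hu.comp (contDiff_id.prodMk contDiff_const)
    have hfc : Continuous fun t => fderiv ℝ (fun z => u (z, t)) z₀ := by
      have h : ∀ t, fderiv ℝ (fun z => u (z, t)) z₀ =
          (fderiv ℝ u (z₀, t)).comp (ContinuousLinearMap.inl ℝ P ℝ) := fun t =>
        ((hu.differentiable (by simp) _).hasFDerivAt.comp z₀
          (hasFDerivAt_prodMk_left z₀ t)).fderiv
      simp_rw [h]
      exact ((hu.continuous_fderiv (by simp)).comp (by fun_prop)).clm_comp continuous_const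
    refine hasFDerivAt_integral_of_dominated_of_fderiv_le (bound := b₁)
      (F' := fun z t => fderiv ℝ (fun z => u (z, t)) z)
      (Metric.ball_mem_nhds z₀ one_pos) ?_ ?_ ?_ ?_ hb₁ ?_
    · exact Filter.Eventually.of_forall fun z =>
        (hu.continuous.comp (by fun_prop : Continuous fun t : ℝ => (z, t))).aestronglyMeasurable
    · refine hb₀.mono' (hu.continuous.comp
        (by fun_prop : Continuous fun t : ℝ => (z₀, t))).aestronglyMeasurable
        (hb₀'.mono fun t ht => ?_)
      simpa using ht z₀ le_rfl
    · exact hfc.aestronglyMeasurable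
    · refine hb₁'.mono fun t ht z hz => ?_
      have hz' : ‖z‖ ≤ ‖z₀‖ + 1 := by
        have := norm_sub_norm_le z z₀
        rw [Metric.mem_ball, dist_eq_norm] at hz
        linarith
      simpa [norm_iteratedFDeriv_one] using ht z hz'
    · exact ae_of_all _ fun t z _ => ((hut t).differentiable (by simp) z).hasFDerivAt
  induction n with
  | zero =>
    intro V _ _ _ u hu hb
    rw [Nat.cast_zero, contDiff_zero]
    exact continuous_iff_continuousAt.2 fun z => (hder hu hb z).continuousAt
  | succ n ih =>
    intro V _ _ _ u hu hb
    rw [Nat.cast_succ, contDiff_succ_iff_fderiv]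
    refine ⟨fun z => (hder hu hb z).differentiableAt, by simp, ?_⟩
    have h1 : (fderiv ℝ fun z => ∫ t, u (z, t) ∂ν) =
        fun z => ∫ t, fderiv ℝ (fun z => u (z, t)) z ∂ν :=
      funext fun z => (hder hu hb z).fderiv
    rw [h1]
    have h2 : ∀ z t, fderiv ℝ (fun z => u (z, t)) z =
        (fderiv ℝ u (z, t)).comp (ContinuousLinearMap.inl ℝ P ℝ) := fun z t =>
      ((hu.differentiable (by simp) _).hasFDerivAt.comp z
        (hasFDerivAt_prodMk_left z t)).fderiv
    refine ih (u := fun y => fderiv ℝ (fun z => u (z, y.2)) y.1) ?_ fun k R => ?_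
    · simp_rw [h2]
      exact (hu.fderiv_right (m := ∞) (by simp)).clm_comp contDiff_const
    · obtain ⟨b, hb, hb'⟩ := hb (k + 1) R
      refine ⟨b, hb, hb'.mono fun t ht z hz => ?_⟩
      have h3 := norm_iteratedFDeriv_fderiv (𝕜 := ℝ) (f := fun z => u (z, t)) (n := k) (x := z)
      exact h3.trans_le (ht z hz)

theorem contDiff_integral_of_dominated {V : Type} [NormedAddCommGroup V] [NormedSpace ℝ V]
    [CompleteSpace V] (ν : Measure ℝ) {u : P × ℝ → V} (hu : ContDiff ℝ ∞ u)
    (hb : ∀ (k : ℕ) (R : ℝ), ∃ b : ℝ → ℝ, Integrable b ν ∧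
      ∀ᵐ t ∂ν, ∀ z, ‖z‖ ≤ R → ‖iteratedFDeriv ℝ k (fun z => u (z, t)) z‖ ≤ b t) :
    ContDiff ℝ ∞ fun z => ∫ t, u (z, t) ∂ν :=
  contDiff_infty.2 fun n => contDiff_nat_integral_of_dominated ν n hu hb

/-- Rescaling to `[0, 1]` moves the variable endpoint into the integrand, where compactness provides
the dominating constants. -/
theorem contDiff_intervalIntegral_of_contDiff [FiniteDimensional ℝ P] {g : P × ℝ → ℝ}
    (hg : ContDiff ℝ ∞ g) :
    ContDiff ℝ ∞ fun y : P × ℝ => ∫ s in (0 : ℝ)..y.2, g (y.1, s) := by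
  have h1 : ∀ y : P × ℝ, ∫ s in (0 : ℝ)..y.2, g (y.1, s) =
      ∫ s in Icc (0 : ℝ) 1, y.2 * g (y.1, y.2 * s) := by
    intro y
    have h := intervalIntegral.mul_integral_comp_mul_left (a := 0) (b := 1)
      (f := fun s => g (y.1, s)) (c := y.2)
    rw [mul_zero, mul_one] at h
    rw [← h, integral_Icc_eq_integral_Ioc, ← intervalIntegral.integral_of_le zero_le_one,
      intervalIntegral.integral_const_mul]
  simp_rw [h1]
  set u : (P × ℝ) × ℝ → ℝ := fun y => y.1.2 * g (y.1.1, y.1.2 * y.2) with hu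
  have huc : ContDiff ℝ ∞ u := by
    refine ContDiff.mul (by fun_prop) (hg.comp ?_)
    fun_prop
  have hK : ∀ (k : ℕ) (R : ℝ), ∃ C, ∀ (z : P × ℝ) (s : ℝ), ‖z‖ ≤ R → s ∈ Icc (0 : ℝ) 1 →
      ‖iteratedFDeriv ℝ k (fun z => u (z, s)) z‖ ≤ C := by
    intro k R
    obtain ⟨C, hC⟩ := ((isCompact_closedBall (0 : P × ℝ) R).prod
      (isCompact_Icc (a := (0 : ℝ)) (b := 1))).exists_bound_of_continuousOn
      (huc.continuous_iteratedFDeriv (m := k) (by exact_mod_cast le_top)).continuousOn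
    refine ⟨C, fun z s hz hs => (norm_iteratedFDeriv_left_le huc k z s).trans
      (hC (z, s) ⟨by simpa using hz, hs⟩)⟩
  refine contDiff_integral_of_dominated (volume.restrict (Icc 0 1)) huc fun k R => ?_
  obtain ⟨C, hC⟩ := hK k R
  refine ⟨fun _ => C, integrable_const _, ?_⟩
  filter_upwards [ae_restrict_mem measurableSet_Icc] with s hs z hz
  exact hC z s hz hs

end ParametricIntegral

/-! ### A shear that makes all parameter derivatives integrable. -/

section Shear

open Set

variable {P : Type} [NormedAddCommGroup P] [NormedSpace ℝ P] [FiniteDimensional ℝ P]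

theorem exists_bound_iteratedFDeriv {f : P × ℝ → ℝ} (hf : ContDiff ℝ ∞ f) (k : ℕ) (R M : ℝ) :
    ∃ C, 0 ≤ C ∧ ∀ (z : P) (t : ℝ), ‖z‖ ≤ R → |t| ≤ M → ‖iteratedFDeriv ℝ k f (z, t)‖ ≤ C := by
  obtain ⟨C, hC⟩ := ((isCompact_closedBall (0 : P) R).prod
    (isCompact_closedBall (0 : ℝ) M)).exists_bound_of_continuousOn
    (hf.continuous_iteratedFDeriv (m := k) (by exact_mod_cast le_top)).continuousOn
  exact ⟨max C 0, le_max_right _ _, fun z t hz ht =>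
    (hC (z, t) ⟨by simpa using hz, by simpa using ht⟩).trans (le_max_left _ _)⟩

/-- There is a smooth positive function of `t` that decays so fast that it makes all the
derivatives of `f` integrable in `t`, locally uniformly in the other variable. -/
theorem exists_contDiff_mul_iteratedFDeriv_le {f : P × ℝ → ℝ} (hf : ContDiff ℝ ∞ f) :
    ∃ a : ℝ → ℝ, ContDiff ℝ ∞ a ∧ (∀ t, 0 < a t) ∧ (∀ t, a t ≤ 1) ∧
      ∀ (k : ℕ) (R : ℝ), ∃ b : ℝ → ℝ, Integrable b ∧
        ∀ t z, ‖z‖ ≤ R → a t * ‖iteratedFDeriv ℝ k f (z, t)‖ ≤ b t := by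
  -- Only orders and radii up to `|s|` are constrained at `s`. Locally these are finitely many
  -- conditions on a compact set, yet each pair `(k, R)` is covered for all large `|s|`.
  set S : ℝ → Set ℝ := fun s => {c | 0 < c ∧ c ≤ 1 ∧ ∀ k : ℕ, (k : ℝ) ≤ |s| → ∀ z : P, ‖z‖ ≤ |s| →
    c * ‖iteratedFDeriv ℝ k f (z, s)‖ ≤ (1 + s ^ 2)⁻¹} with hS
  have hconv : ∀ s, Convex ℝ (S s) := fun s => by
    refine OrdConnected.convex ⟨fun x hx y hy c hc => ?_⟩
    refine ⟨hx.1.trans_le hc.1, hc.2.trans hy.2.1, fun k hk z hz => ?_⟩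
    exact (mul_le_mul_of_nonneg_right hc.2 (norm_nonneg _)).trans (hy.2.2 k hk z hz)
  have hloc : ∀ x : ℝ, ∃ c : ℝ, ∀ᶠ s in nhds x, c ∈ S s := by
    intro x
    set M := |x| + 1 with hM
    choose C hC0 hC using fun k => exists_bound_iteratedFDeriv hf k M M
    set N := ⌊M⌋₊
    set D := 1 + ∑ k ∈ Finset.range (N + 1), C k with hD
    have hD1 : 1 ≤ D := le_add_of_nonneg_right (Finset.sum_nonneg fun k _ => hC0 k)
    have hM2 : (0 : ℝ) < 1 + M ^ 2 := by positivity
    refine ⟨((1 + M ^ 2) * D)⁻¹, ?_⟩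
    filter_upwards [Metric.ball_mem_nhds x one_pos] with s hs
    have hsM : |s| ≤ M := by
      have := abs_sub_abs_le_abs_sub s x
      rw [Metric.mem_ball, Real.dist_eq] at hs
      linarith
    refine ⟨by positivity, inv_le_one_of_one_le₀ (by nlinarith), fun k hk z hz => ?_⟩
    have h1 : ‖iteratedFDeriv ℝ k f (z, s)‖ ≤ D := by
      refine (hC k z s (hz.trans hsM) hsM).trans ?_
      have hkN : k ∈ Finset.range (N + 1) :=
        Finset.mem_range.2 (Nat.lt_succ_of_le (Nat.le_floor (hk.trans hsM)))
      have := Finset.single_le_sum (f := C) (fun k _ => hC0 k) hkN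
      linarith
    calc ((1 + M ^ 2) * D)⁻¹ * ‖iteratedFDeriv ℝ k f (z, s)‖ ≤ ((1 + M ^ 2) * D)⁻¹ * D := by
          gcongr
      _ = (1 + M ^ 2)⁻¹ := by field_simp
      _ ≤ (1 + s ^ 2)⁻¹ := by
          have : s ^ 2 ≤ M ^ 2 := by rw [← sq_abs s]; gcongr
          gcongr
  -- A partition of unity glues the local constants, since each `S s` is convex.
  obtain ⟨a, ha⟩ := exists_contMDiffMap_forall_mem_convex_of_local_const
    (n := (⊤ : ℕ∞)) (modelWithCornersSelf ℝ ℝ) hconv hloc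
  refine ⟨a, a.contMDiff.contDiff, fun t => (ha t).1, fun t => (ha t).2.1, fun k R => ?_⟩
  set K := max (k : ℝ) R with hK
  obtain ⟨C, hC0, hC⟩ := exists_bound_iteratedFDeriv hf k R K
  refine ⟨fun t => (C * (1 + K ^ 2) + 1) * (1 + t ^ 2)⁻¹,
    integrable_inv_one_add_sq.const_mul _, fun t z hz => ?_⟩
  have ht2 : (0 : ℝ) < 1 + t ^ 2 := by positivity
  rcases le_or_gt K |t| with h | h
  · refine ((ha t).2.2 k ((le_max_left _ _).trans h) z
      (hz.trans ((le_max_right _ _).trans h))).trans ?_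
    refine le_mul_of_one_le_left (by positivity) ?_
    have : 0 ≤ C * (1 + K ^ 2) := by positivity
    linarith
  · have h1 : a t * ‖iteratedFDeriv ℝ k f (z, t)‖ ≤ C :=
      (mul_le_of_le_one_left (norm_nonneg _) (ha t).2.1).trans (hC z t hz h.le)
    refine h1.trans ?_
    change C ≤ (C * (1 + K ^ 2) + 1) * (1 + t ^ 2)⁻¹
    rw [← div_eq_mul_inv, le_div_iff₀ ht2]
    have h2 : t ^ 2 ≤ K ^ 2 := by rw [← sq_abs t]; gcongr
    nlinarith

/-- Each derivative in `z` brings a further factor `c ≤ 1`, and `c ^ m ≤ c` since `m ≠ 0`; one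
factor `c` always survives. -/
theorem norm_iteratedFDeriv_shear_le {P : Type} [NormedAddCommGroup P] [NormedSpace ℝ P]
    {f : P × ℝ → ℝ} (hf : ContDiff ℝ ∞ f) {c : ℝ} (hc0 : 0 < c)
    (hc1 : c ≤ 1) {m : ℕ} (hm : m ≠ 0) (k : ℕ) (z : P) (t : ℝ) :
    ‖iteratedFDeriv ℝ k (fun z => c ^ m * f (c • z, t)) z‖ ≤
      c * ‖iteratedFDeriv ℝ k f (c • z, t)‖ := by
  have hft : ContDiff ℝ ∞ fun z => f (z, t) := hf.comp (contDiff_id.prodMk contDiff_const)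
  have h1 : (fun z => c ^ m * f (c • z, t)) =
      c ^ m • ((fun z => f (z, t)) ∘ (c • ContinuousLinearMap.id ℝ P)) := by
    ext z; simp
  have hcomp : ContDiff ℝ ∞ ((fun z => f (z, t)) ∘ (c • ContinuousLinearMap.id ℝ P)) :=
    hft.comp (ContinuousLinearMap.contDiff _)
  rw [h1, iteratedFDeriv_const_smul_apply (hcomp.of_le (by exact_mod_cast le_top)).contDiffAt,
    norm_smul, ContinuousLinearMap.iteratedFDeriv_comp_right _ hft z (by exact_mod_cast le_top)]
  have h2 : ‖c • ContinuousLinearMap.id ℝ P‖ ≤ 1 := by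
    rw [norm_smul, Real.norm_of_nonneg hc0.le]
    exact mul_le_one₀ hc1 (norm_nonneg _) ContinuousLinearMap.norm_id_le
  have h3 : ∏ _i : Fin k, ‖c • ContinuousLinearMap.id ℝ P‖ ≤ 1 :=
    Finset.prod_le_one (fun _ _ => norm_nonneg _) fun _ _ => h2
  have h4 : c ^ m ≤ c := pow_le_of_le_one hc0.le hc1 hm
  rw [Real.norm_of_nonneg (by positivity)]
  refine mul_le_mul h4 ?_ (norm_nonneg _) hc0.le
  refine (ContinuousMultilinearMap.norm_compContinuousLinearMap_le _ _).trans ?_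
  refine (mul_le_of_le_one_right (norm_nonneg _) h3).trans ?_
  simpa using norm_iteratedFDeriv_left_le hf k (c • z) t

theorem exists_shear_dominated {f : P × ℝ → ℝ} (hf : ContDiff ℝ ∞ f) {m : ℕ} (hm : m ≠ 0) :
    ∃ a : ℝ → ℝ, ContDiff ℝ ∞ a ∧ (∀ t, 0 < a t) ∧
      ∀ (k : ℕ) (R : ℝ), ∃ b : ℝ → ℝ, Integrable b ∧ ∀ t z, ‖z‖ ≤ R →
        ‖iteratedFDeriv ℝ k (fun z => a t ^ m * f (a t • z, t)) z‖ ≤ b t := by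
  obtain ⟨a, ha, ha0, ha1, hb⟩ := exists_contDiff_mul_iteratedFDeriv_le hf
  refine ⟨a, ha, ha0, fun k R => ?_⟩
  obtain ⟨b, hbi, hb'⟩ := hb k R
  refine ⟨b, hbi, fun t z hz => (norm_iteratedFDeriv_shear_le hf (ha0 t) (ha1 t) hm k z t).trans
    (hb' t _ ?_)⟩
  rw [norm_smul, Real.norm_of_nonneg (ha0 t).le]
  exact (mul_le_of_le_one_left (norm_nonneg _) (ha1 t)).trans hz

end Shear

/-! ### Smooth equivalence of measures and fibrewise changes of variables. -/

section SmoothEquivalence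

open Set Filter Topology

/-- A smooth bijection with bijective derivatives has a smooth inverse. -/
theorem contDiff_symm_of_hasFDerivAt_equiv {E E' : Type} [NormedAddCommGroup E]
    [NormedSpace ℝ E] [NormedAddCommGroup E'] [NormedSpace ℝ E'] [CompleteSpace E]
    (T : E ≃ E') (hT : ContDiff ℝ ∞ T)
    (hT' : ∀ x, ∃ L : E ≃L[ℝ] E', HasFDerivAt T (L : E →L[ℝ] E') x) : ContDiff ℝ ∞ T.symm := by
  rw [contDiff_iff_contDiffAt]
  intro y
  obtain ⟨x, rfl⟩ := T.surjective y
  obtain ⟨L, hL⟩ := hT' x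
  have hne : (∞ : WithTop ℕ∞) ≠ 0 := by simp
  -- By injectivity the global inverse agrees near `T x` with the smooth local inverse of the
  -- inverse function theorem.
  refine ((hT.contDiffAt (x := x)).to_localInverse hL hne).congr_of_eventuallyEq ?_
  filter_upwards [((hT.contDiffAt (x := x)).hasStrictFDerivAt' hL hne).eventually_right_inverse]
    with y hy
  rw [Equiv.symm_apply_eq]
  exact hy.symm

/-- Smooth families of increasing bijections of the line define diffeomorphisms. -/
theorem exists_equiv_fiberwise {E : Type} [NormedAddCommGroup E] [NormedSpace ℝ E]
    [FiniteDimensional ℝ E] {h : E × ℝ → ℝ} (hh : ContDiff ℝ ∞ h)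
    {h' : E × ℝ → ℝ} (hd : ∀ z t, HasDerivAt (fun t => h (z, t)) (h' (z, t)) t)
    (hpos : ∀ y, 0 < h' y) (htop : ∀ z, Tendsto (fun t => h (z, t)) atTop atTop)
    (hbot : ∀ z, Tendsto (fun t => h (z, t)) atBot atBot) :
    ∃ T : (E × ℝ) ≃ (E × ℝ), ContDiff ℝ ∞ T ∧ ContDiff ℝ ∞ T.symm ∧ ∀ y, T y = (y.1, h y) := by
  have hmono : ∀ z, StrictMono fun t => h (z, t) := fun z =>
    strictMono_of_hasDerivAt_pos (hd z) fun t => hpos (z, t)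
  have hsurj : ∀ z, Function.Surjective fun t => h (z, t) := fun z =>
    (hh.continuous.comp (by fun_prop : Continuous fun t : ℝ => (z, t))).surjective
      (htop z) (hbot z)
  have hbij : Function.Bijective fun y : E × ℝ => (y.1, h y) := by
    refine ⟨?_, ?_⟩
    · rintro ⟨z, t⟩ ⟨z', t'⟩ h1
      obtain ⟨rfl, h2⟩ := Prod.mk.inj h1
      rw [(hmono z).injective h2]
    · rintro ⟨z, s⟩
      obtain ⟨t, rfl⟩ := hsurj z s
      exact ⟨(z, t), rfl⟩
  have hsm : ContDiff ℝ ∞ (Equiv.ofBijective _ hbij) := contDiff_fst.prodMk hh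
  have : CompleteSpace (E × ℝ) := FiniteDimensional.complete ℝ _
  refine ⟨Equiv.ofBijective _ hbij, hsm, ?_, fun y => rfl⟩
  refine contDiff_symm_of_hasFDerivAt_equiv _ hsm fun y => ?_
  have h1 : HasFDerivAt h (fderiv ℝ h y) y := (hh.differentiable (by simp) y).hasFDerivAt
  have h2 := (hasFDerivAt_fst (𝕜 := ℝ) (p := y)).prodMk h1
  have h3 : fderiv ℝ h y (0, 1) = h' y := by
    have h4 : HasDerivAt (fun t : ℝ => (y.1, t)) ((0 : E), (1 : ℝ)) y.2 :=
      (hasDerivAt_const _ _).prodMk (hasDerivAt_id _)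
    exact (h1.comp_hasDerivAt y.2 h4).unique (hd y.1 y.2)
  have hinj : Function.Injective
      (((ContinuousLinearMap.fst ℝ E ℝ).prod (fderiv ℝ h y) : E × ℝ →L[ℝ] E × ℝ) :
        E × ℝ →ₗ[ℝ] E × ℝ) := by
    rw [injective_iff_map_eq_zero]
    rintro ⟨v, s⟩ hv
    obtain ⟨h5, h6⟩ := Prod.mk.inj (show (v, fderiv ℝ h y (v, s)) = ((0 : E), (0 : ℝ)) from hv)
    subst h5
    have h7 : ((0 : E), s) = s • ((0 : E), (1 : ℝ)) := by simp
    rw [h7, map_smul, h3, smul_eq_mul, mul_eq_zero] at h6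
    rw [h6.resolve_right (hpos y).ne']
    rfl
  refine ⟨(LinearEquiv.ofInjectiveEndo _ hinj).toContinuousLinearEquiv, ?_⟩
  exact h2

variable {E E' : Type} [NormedAddCommGroup E] [NormedSpace ℝ E] [MeasurableSpace E] [BorelSpace E]
  [NormedAddCommGroup E'] [NormedSpace ℝ E'] [MeasurableSpace E'] [BorelSpace E']

/-- Two measures are smoothly equivalent if a smooth diffeomorphism transports one to the other. -/
def SmoothlyEquivalent (μ : Measure E) (ν : Measure E') : Prop :=
  ∃ T : E ≃ E', ContDiff ℝ ∞ T ∧ ContDiff ℝ ∞ T.symm ∧ Measure.map T μ = ν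

theorem SmoothlyEquivalent.symm {μ : Measure E} {ν : Measure E'} (h : SmoothlyEquivalent μ ν) :
    SmoothlyEquivalent ν μ := by
  obtain ⟨T, hT, hT', rfl⟩ := h
  refine ⟨T.symm, hT', hT, ?_⟩
  rw [Measure.map_map hT'.continuous.measurable hT.continuous.measurable]
  simp

theorem SmoothlyEquivalent.trans {E'' : Type} [NormedAddCommGroup E''] [NormedSpace ℝ E'']
    [MeasurableSpace E''] [BorelSpace E''] {μ : Measure E} {ν : Measure E'} {ρ : Measure E''}
    (h : SmoothlyEquivalent μ ν) (h' : SmoothlyEquivalent ν ρ) : SmoothlyEquivalent μ ρ := by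
  obtain ⟨T, hT, hT', rfl⟩ := h
  obtain ⟨S, hS, hS', rfl⟩ := h'
  refine ⟨T.trans S, hS.comp hT, hT'.comp hS', ?_⟩
  rw [Measure.map_map hS.continuous.measurable hT.continuous.measurable]
  rfl

theorem SmoothlyEquivalent.prod_right [SecondCountableTopology E] [SecondCountableTopology E']
    {μ : Measure E} {ν : Measure E'} [SFinite μ] (h : SmoothlyEquivalent μ ν) (ℓ : Measure ℝ)
    [SFinite ℓ] : SmoothlyEquivalent (μ.prod ℓ) (ν.prod ℓ) := by
  obtain ⟨T, hT, hT', rfl⟩ := h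
  refine ⟨T.prodCongr (Equiv.refl ℝ), (hT.comp contDiff_fst).prodMk contDiff_snd,
    (hT'.comp contDiff_fst).prodMk contDiff_snd, ?_⟩
  have := Measure.map_prod_map μ ℓ hT.continuous.measurable measurable_id
  rw [Measure.map_id] at this
  rw [this]
  rfl

/-- Change of variables for families of increasing bijections of the line. -/
theorem map_fiberwise_withDensity {E : Type*} [MeasurableSpace E] (lam : Measure E) [SFinite lam]
    {T : E × ℝ → E × ℝ} {h h' k : E × ℝ → ℝ} (hT : Measurable T) (hTh : ∀ y, T y = (y.1, h y))
    (hd : ∀ z t, HasDerivAt (fun t => h (z, t)) (h' (z, t)) t) (hpos : ∀ y, 0 < h' y)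
    (hinj : Function.Bijective T) (hh' : Measurable h') (hk : Measurable k) :
    Measure.map T ((lam.prod volume).withDensity fun y => ENNReal.ofReal (h' y * k (T y))) =
      (lam.prod volume).withDensity fun y => ENNReal.ofReal (k y) := by
  refine Measure.ext_of_lintegral _ fun φ hφ => ?_
  have hφT : Measurable fun y => φ (T y) := hφ.comp hT
  have hm1 : Measurable fun y => ENNReal.ofReal (h' y * k (T y)) :=
    (hh'.mul (hk.comp hT)).ennreal_ofReal
  rw [lintegral_map hφ hT, lintegral_withDensity_eq_lintegral_mul _ hm1 (g := fun y => φ (T y)) hφT,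
    lintegral_withDensity_eq_lintegral_mul _ hk.ennreal_ofReal hφ,
    lintegral_prod _ (hm1.mul hφT).aemeasurable,
    lintegral_prod _ (hk.ennreal_ofReal.mul hφ).aemeasurable]
  refine lintegral_congr fun z => ?_
  have hin : InjOn (fun t => h (z, t)) univ := fun t _ t' _ htt => by
    have : T (z, t) = T (z, t') := by rw [hTh, hTh]; exact Prod.ext rfl htt
    exact (Prod.mk.inj (hinj.1 this)).2
  have him : (fun t => h (z, t)) '' univ = univ := by
    rw [image_univ, range_eq_univ]
    intro s
    obtain ⟨⟨z', t⟩, ht⟩ := hinj.2 (z, s)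
    rw [hTh] at ht
    obtain ⟨rfl, h2⟩ := Prod.mk.inj ht
    exact ⟨t, h2⟩
  have := lintegral_image_eq_lintegral_abs_deriv_mul (s := univ) (f := fun t => h (z, t))
    (f' := fun t => h' (z, t)) MeasurableSet.univ (fun t _ => (hd z t).hasDerivWithinAt) hin
    fun s => ENNReal.ofReal (k (z, s)) * φ (z, s)
  rw [him, setLIntegral_univ, setLIntegral_univ] at this
  refine Eq.trans ?_ this.symm
  refine lintegral_congr fun t => ?_
  have h1 : T (z, t) = (z, h (z, t)) := hTh _
  simp only [Pi.mul_apply, h1]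
  rw [abs_of_pos (hpos _), ENNReal.ofReal_mul (hpos _).le, mul_assoc]

end SmoothEquivalence

/-! ### The logit map and the logistic law. -/

section Logistic

open Set Filter Topology

/-- The density of the standard logistic distribution. -/
noncomputable def logisticDensity (s : ℝ) : ℝ := Real.exp s / (1 + Real.exp s) ^ 2

theorem continuous_logisticDensity : Continuous logisticDensity := by
  unfold logisticDensity
  exact Real.continuous_exp.div (by fun_prop) fun s => by positivity

theorem hasDerivAt_logit {A : ℝ → ℝ} {a F t : ℝ} (hA : HasDerivAt A a t) (h0 : 0 < A t)
    (h1 : A t < F) :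
    HasDerivAt (fun t => Real.log (A t) - Real.log (F - A t)) (a * F / (A t * (F - A t))) t := by
  have h2 : 0 < F - A t := sub_pos.2 h1
  refine ((hA.log h0.ne').sub ((hA.const_sub F).log h2.ne')).congr_deriv ?_
  field_simp
  ring

/-- With `a = A'`, this is the Jacobian equation for transporting the density `a`, of mass `F`, to
`F` times the logistic density by the logit of `A / F`. -/
theorem mul_logisticDensity_logit {a F A : ℝ} (h0 : 0 < A) (h1 : A < F) :
    a * F / (A * (F - A)) * (F * logisticDensity (Real.log A - Real.log (F - A))) = a := by
  have h2 : 0 < F - A := sub_pos.2 h1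
  have h3 : F ≠ 0 := (h0.trans h1).ne'
  rw [logisticDensity, ← Real.log_div h0.ne' h2.ne', Real.exp_log (by positivity)]
  have h4 : 1 + A / (F - A) = F / (F - A) := by field_simp; ring
  rw [h4]
  field_simp

theorem tendsto_logit_atTop {ι : Type*} {l : Filter ι} {A : ι → ℝ} {F : ℝ} (hF : 0 < F)
    (hA : Tendsto A l (𝓝 F)) (h1 : ∀ i, A i < F) :
    Tendsto (fun i => Real.log (A i) - Real.log (F - A i)) l atTop := by
  have h2 : Tendsto (fun i => Real.log (F - A i)) l atBot := by
    refine Real.tendsto_log_nhdsGT_zero.comp (tendsto_nhdsWithin_iff.2 ⟨?_, .of_forall fun i =>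
      sub_pos.2 (h1 i)⟩)
    simpa using hA.const_sub F
  simp only [sub_eq_add_neg]
  exact (hA.log hF.ne').add_atTop (tendsto_neg_atBot_atTop.comp h2)

theorem tendsto_logit_atBot {ι : Type*} {l : Filter ι} {A : ι → ℝ} {F : ℝ} (hF : 0 < F)
    (hA : Tendsto A l (𝓝 0)) (h1 : ∀ i, 0 < A i) :
    Tendsto (fun i => Real.log (A i) - Real.log (F - A i)) l atBot := by
  have h2 : Tendsto (fun i => Real.log (A i)) l atBot :=
    Real.tendsto_log_nhdsGT_zero.comp (tendsto_nhdsWithin_iff.2 ⟨hA, .of_forall h1⟩)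
  have h3 : Tendsto (fun i => Real.log (F - A i)) l (𝓝 (Real.log F)) := by
    have : Tendsto (fun i => F - A i) l (𝓝 F) := by simpa using hA.const_sub F
    exact this.log hF.ne'
  simp only [sub_eq_add_neg]
  exact h2.atBot_add h3.neg

end Logistic

/-! ### Shearing a density and straightening it into a product. -/

section Disintegration

open Set Filter Topology

variable {E : Type} [NormedAddCommGroup E] [NormedSpace ℝ E]

/-- The shear `(z, t) ↦ (a(t)⁻¹ z, t)`. -/
noncomputable def shearEquiv (a : ℝ → ℝ) (ha : ∀ t, 0 < a t) : (E × ℝ) ≃ (E × ℝ) where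
  toFun y := ((a y.2)⁻¹ • y.1, y.2)
  invFun y := (a y.2 • y.1, y.2)
  left_inv y := by simp [smul_smul, (ha y.2).ne']
  right_inv y := by simp [smul_smul, (ha y.2).ne']

theorem contDiff_shearEquiv {a : ℝ → ℝ} (ha : ∀ t, 0 < a t) (hsm : ContDiff ℝ ∞ a) :
    ContDiff ℝ ∞ (shearEquiv (E := E) a ha) :=
  (((hsm.comp contDiff_snd).inv fun y => (ha y.2).ne').smul contDiff_fst).prodMk contDiff_snd

theorem contDiff_shearEquiv_symm {a : ℝ → ℝ} (ha : ∀ t, 0 < a t) (hsm : ContDiff ℝ ∞ a) :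
    ContDiff ℝ ∞ (shearEquiv (E := E) a ha).symm :=
  ((hsm.comp contDiff_snd).smul contDiff_fst).prodMk contDiff_snd

variable [FiniteDimensional ℝ E] [MeasurableSpace E] [BorelSpace E]

theorem map_shearEquiv_withDensity (lam : Measure E) [lam.IsAddHaarMeasure] {a : ℝ → ℝ}
    (ha : ∀ t, 0 < a t) (hsm : ContDiff ℝ ∞ a) {f : E × ℝ → ℝ} (hf : Measurable f) :
    Measure.map (shearEquiv a ha) ((lam.prod volume).withDensity fun y => ENNReal.ofReal (f y)) =
      (lam.prod volume).withDensity fun y =>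
        ENNReal.ofReal (a y.2 ^ Module.finrank ℝ E * f (a y.2 • y.1, y.2)) := by
  refine Measure.ext_of_lintegral _ fun φ hφ => ?_
  have hT : Measurable (shearEquiv (E := E) a ha) :=
    (contDiff_shearEquiv ha hsm).continuous.measurable
  have hφT : Measurable fun y => φ (shearEquiv a ha y) := hφ.comp hT
  have ham : Measurable a := hsm.continuous.measurable
  have hS : Measurable fun y : E × ℝ => f (a y.2 • y.1, y.2) :=
    hf.comp (contDiff_shearEquiv_symm ha hsm).continuous.measurable
  have hg : Measurable fun y : E × ℝ =>
      ENNReal.ofReal (a y.2 ^ Module.finrank ℝ E * f (a y.2 • y.1, y.2)) :=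
    (((ham.comp measurable_snd).pow_const _).mul hS).ennreal_ofReal
  rw [lintegral_map hφ hT, lintegral_withDensity_eq_lintegral_mul _ hf.ennreal_ofReal
      (g := fun y => φ (shearEquiv a ha y)) hφT,
    lintegral_withDensity_eq_lintegral_mul _ hg hφ,
    lintegral_prod_symm _ (hf.ennreal_ofReal.mul hφT).aemeasurable,
    lintegral_prod_symm _ (hg.mul hφ).aemeasurable]
  -- At fixed `t` the shear is a dilation of `E`, with Jacobian given by the power `finrank ℝ E`.
  refine lintegral_congr fun t => ?_
  set c := a t with hc
  have hc0 : 0 < c := ha t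
  set G : E → ENNReal := fun z => ENNReal.ofReal (f (z, t)) * φ (c⁻¹ • z, t) with hG
  have hGm : Measurable G :=
    (hf.comp (measurable_id.prodMk measurable_const)).ennreal_ofReal.mul
      (hφ.comp ((measurable_const_smul _).prodMk measurable_const))
  have h1 := lintegral_map (μ := lam) hGm (measurable_const_smul c)
  rw [Measure.map_addHaar_smul lam hc0.ne', lintegral_smul_measure] at h1
  have hp : 0 < c ^ Module.finrank ℝ E := by positivity
  have h2 : ∫⁻ z, G z ∂lam = ENNReal.ofReal (c ^ Module.finrank ℝ E) * ∫⁻ z, G (c • z) ∂lam := by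
    rw [← h1, smul_eq_mul, ← mul_assoc, ← ENNReal.ofReal_mul hp.le, abs_of_pos (inv_pos.2 hp),
      mul_inv_cancel₀ hp.ne', ENNReal.ofReal_one, one_mul]
  refine h2.trans ?_
  have hGc : Measurable fun z => G (c • z) := hGm.comp (measurable_const_smul c)
  rw [← lintegral_const_mul _ hGc]
  refine lintegral_congr fun z => ?_
  simp only [hG, Pi.mul_apply, smul_smul, inv_mul_cancel₀ hc0.ne', one_smul]
  rw [ENNReal.ofReal_mul hp.le, mul_assoc]

/-- A density with integrable derivatives is transported to a product. -/
theorem smoothlyEquivalent_prod_of_dominated (lam : Measure E) [SFinite lam] {g : E × ℝ → ℝ}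
    (hg : ContDiff ℝ ∞ g) (hpos : ∀ y, 0 < g y)
    (hb : ∀ (k : ℕ) (R : ℝ), ∃ b : ℝ → ℝ, Integrable b ∧ ∀ t z, ‖z‖ ≤ R →
      ‖iteratedFDeriv ℝ k (fun z => g (z, t)) z‖ ≤ b t) :
    ∃ F : E → ℝ, ContDiff ℝ ∞ F ∧ (∀ z, 0 < F z) ∧
      (∀ z, ENNReal.ofReal (F z) = ∫⁻ t, ENNReal.ofReal (g (z, t))) ∧
      SmoothlyEquivalent ((lam.prod volume).withDensity fun y => ENNReal.ofReal (g y))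
        ((lam.withDensity fun z => ENNReal.ofReal (F z)).prod
          (volume.withDensity fun s => ENNReal.ofReal (logisticDensity s))) := by
  have hgz : ∀ z, Continuous fun t => g (z, t) := fun z =>
    hg.continuous.comp (by fun_prop)
  have hint : ∀ z, Integrable fun t => g (z, t) := fun z => by
    obtain ⟨b, hbi, hb0⟩ := hb 0 ‖z‖
    refine hbi.mono' (hgz z).aestronglyMeasurable (.of_forall fun t => ?_)
    simpa using hb0 t z le_rfl
  set L : E → ℝ := fun z => ∫ t in Iic (0 : ℝ), g (z, t) with hL
  set F : E → ℝ := fun z => ∫ t, g (z, t) with hF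
  have hLs : ContDiff ℝ ∞ L := contDiff_integral_of_dominated _ hg fun k R => by
    obtain ⟨b, hbi, hb0⟩ := hb k R
    exact ⟨b, hbi.integrableOn, .of_forall hb0⟩
  have hFs : ContDiff ℝ ∞ F := contDiff_integral_of_dominated _ hg fun k R => by
    obtain ⟨b, hbi, hb0⟩ := hb k R
    exact ⟨b, hbi, .of_forall hb0⟩
  -- The unnormalised conditional distribution function, split at `0` so that joint smoothness
  -- follows from the two results on parametric integrals.
  set A : E × ℝ → ℝ := fun y => L y.1 + ∫ s in (0 : ℝ)..y.2, g (y.1, s) with hA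
  have hAs : ContDiff ℝ ∞ A :=
    (hLs.comp contDiff_fst).add (contDiff_intervalIntegral_of_contDiff hg)
  have hAI : ∀ z t, A (z, t) = ∫ s in Iic t, g (z, s) := fun z t => by
    have := intervalIntegral.integral_Iic_sub_Iic (a := 0) (b := t) (hint z).integrableOn
      (hint z).integrableOn
    simp only [hA, hL, ← this]
    ring
  have hAF : ∀ z t, F z - A (z, t) = ∫ s in Ioi t, g (z, s) := fun z t => by
    have := intervalIntegral.integral_Iic_add_Ioi (b := t) (hint z).integrableOn
      (hint z).integrableOn
    rw [hAI, sub_eq_iff_eq_add', this]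
  have hposint : ∀ z (s : Set ℝ), volume s ≠ 0 → 0 < ∫ t in s, g (z, t) := fun z s hs => by
    rw [integral_pos_iff_support_of_nonneg (fun t => (hpos (z, t)).le) (hint z).integrableOn]
    have : Function.support (fun t => g (z, t)) = univ :=
      eq_univ_of_forall fun t => (hpos (z, t)).ne'
    rw [this, Measure.restrict_apply_univ]
    exact hs.bot_lt
  have hA0 : ∀ y, 0 < A y := fun y => by
    rw [← Prod.mk.eta (p := y), hAI]
    exact hposint _ _ (by simp)
  have hA1 : ∀ y, A y < F y.1 := fun y => by
    rw [← sub_pos, ← Prod.mk.eta (p := y), hAF]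
    exact hposint _ _ (by simp)
  have hF0 : ∀ z, 0 < F z := fun z => (hA0 (z, 0)).trans (hA1 (z, 0))
  have hAd : ∀ z t, HasDerivAt (fun t => A (z, t)) (g (z, t)) t := fun z t =>
    ((hgz z).integral_hasStrictDerivAt 0 t).hasDerivAt.const_add (L z)
  -- The logistic law is a convenient target because its quantile function is this explicit smooth
  -- logit.
  set h : E × ℝ → ℝ := fun y => Real.log (A y) - Real.log (F y.1 - A y) with hh
  set h' : E × ℝ → ℝ := fun y => g y * F y.1 / (A y * (F y.1 - A y)) with hh'
  have hBs : ContDiff ℝ ∞ fun y : E × ℝ => F y.1 - A y := (hFs.comp contDiff_fst).sub hAs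
  have hhs : ContDiff ℝ ∞ h := (hAs.log fun y => (hA0 y).ne').sub
    (hBs.log fun y => (sub_pos.2 (hA1 y)).ne')
  have hd : ∀ z t, HasDerivAt (fun t => h (z, t)) (h' (z, t)) t := fun z t =>
    hasDerivAt_logit (hAd z t) (hA0 _) (hA1 (z, t))
  have hh'0 : ∀ y, 0 < h' y := fun y =>
    div_pos (mul_pos (hpos y) (hF0 _)) (mul_pos (hA0 y) (sub_pos.2 (hA1 y)))
  have hh'c : Continuous h' := by
    refine (hg.continuous.mul (hFs.continuous.comp continuous_fst)).div
      (hAs.continuous.mul hBs.continuous) fun y => (mul_pos (hA0 y) (sub_pos.2 (hA1 y))).ne'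
  have hlim : ∀ z, Tendsto (fun t => A (z, t)) atTop (𝓝 (F z)) := fun z => by
    have h1 := intervalIntegral_tendsto_integral_Ioi 0 (hint z).integrableOn tendsto_id
    have h2 := h1.const_add (L z)
    rwa [intervalIntegral.integral_Iic_add_Ioi (hint z).integrableOn (hint z).integrableOn] at h2
  have hlim' : ∀ z, Tendsto (fun t => A (z, t)) atBot (𝓝 0) := fun z => by
    simp only [hAI]
    exact tendsto_integral_Iic_zero tendsto_id
  obtain ⟨T, hT, hT', hTh⟩ := exists_equiv_fiberwise hhs hd hh'0
    (fun z => tendsto_logit_atTop (hF0 z) (hlim z) fun t => hA1 (z, t))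
    (fun z => tendsto_logit_atBot (hF0 z) (hlim' z) fun t => hA0 (z, t))
  refine ⟨F, hFs, hF0, fun z => ofReal_integral_eq_lintegral_ofReal (hint z)
    (.of_forall fun t => (hpos (z, t)).le), T, hT, hT', ?_⟩
  have hk : Measurable fun y : E × ℝ => F y.1 * logisticDensity y.2 :=
    ((hFs.continuous.comp continuous_fst).mul
      (continuous_logisticDensity.comp continuous_snd)).measurable
  have hmain := map_fiberwise_withDensity lam (k := fun y => F y.1 * logisticDensity y.2)
    hT.continuous.measurable hTh hd hh'0 T.bijective hh'c.measurable hk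
  have h1 : ∀ y, h' y * (F (T y).1 * logisticDensity (T y).2) = g y := fun y => by
    rw [hTh]
    exact mul_logisticDensity_logit (hA0 y) (hA1 y)
  simp only [h1] at hmain
  rw [hmain, prod_withDensity hFs.continuous.measurable.ennreal_ofReal
    continuous_logisticDensity.measurable.ennreal_ofReal]
  congr 1
  ext y
  rw [ENNReal.ofReal_mul (hF0 _).le]

end Disintegration

/-! ### Smooth transport between positive smooth densities, by induction on dimension. -/

section SmoothTransport

open Set Filter Topology

variable {E E' : Type} [NormedAddCommGroup E] [NormedSpace ℝ E] [MeasurableSpace E] [BorelSpace E]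
  [NormedAddCommGroup E'] [NormedSpace ℝ E'] [MeasurableSpace E'] [BorelSpace E']

theorem SmoothlyEquivalent.isProbabilityMeasure {μ : Measure E} {ν : Measure E'}
    (h : SmoothlyEquivalent μ ν) [IsProbabilityMeasure μ] : IsProbabilityMeasure ν := by
  obtain ⟨T, hT, -, rfl⟩ := h
  exact Measure.isProbabilityMeasure_map hT.continuous.measurable.aemeasurable

/-- All probability measures with smooth positive densities with respect to `lam` are smoothly
equivalent. -/
def HasSmoothTransport (lam : Measure E) : Prop :=
  ∀ f g : E → ℝ, ContDiff ℝ ∞ f → (∀ x, 0 < f x) → ContDiff ℝ ∞ g → (∀ x, 0 < g x) →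
    IsProbabilityMeasure (lam.withDensity fun x => ENNReal.ofReal (f x)) →
    IsProbabilityMeasure (lam.withDensity fun x => ENNReal.ofReal (g x)) →
    SmoothlyEquivalent (lam.withDensity fun x => ENNReal.ofReal (f x))
      (lam.withDensity fun x => ENNReal.ofReal (g x))

theorem hasSmoothTransport_of_subsingleton {E : Type} [NormedAddCommGroup E] [NormedSpace ℝ E]
    [MeasurableSpace E] [Subsingleton E] (lam : Measure E) :
    HasSmoothTransport lam := by
  intro f g _ _ _ _ hf hg
  refine ⟨Equiv.refl E, contDiff_id, contDiff_id, Measure.ext fun s _ => ?_⟩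
  rw [Equiv.coe_refl, Measure.map_id]
  rcases s.eq_empty_or_nonempty with rfl | hs
  · simp
  · rw [Subsingleton.eq_univ_of_nonempty hs, measure_univ, measure_univ]

/-- A linear isomorphism carries one Haar measure to a multiple of the other; the constant is
absorbed into the density. -/
theorem exists_smoothlyEquivalent_withDensity [FiniteDimensional ℝ E] [FiniteDimensional ℝ E']
    (lam : Measure E) [lam.IsAddHaarMeasure] (lam' : Measure E') [lam'.IsAddHaarMeasure]
    (e : E ≃L[ℝ] E') {f : E' → ℝ} (hf : ContDiff ℝ ∞ f) (hpos : ∀ x, 0 < f x) :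
    ∃ f₀ : E → ℝ, ContDiff ℝ ∞ f₀ ∧ (∀ x, 0 < f₀ x) ∧
      SmoothlyEquivalent (lam.withDensity fun x => ENNReal.ofReal (f₀ x))
        (lam'.withDensity fun x => ENNReal.ofReal (f x)) := by
  have hH : (lam.map e).IsAddHaarMeasure := e.isAddHaarMeasure_map lam
  set c := Measure.addHaarScalarFactor lam' (lam.map e) with hc
  have hlam : lam' = c • lam.map e := Measure.isAddLeftInvariant_eq_smul lam' (lam.map e)
  have hc0 : 0 < c := Measure.addHaarScalarFactor_pos_of_isAddHaarMeasure _ _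
  refine ⟨fun x => c * f (e x), contDiff_const.mul (hf.comp e.contDiff),
    fun x => mul_pos hc0 (hpos _), e.toEquiv, e.contDiff, e.symm.contDiff, ?_⟩
  have hm : Measurable fun x => ENNReal.ofReal (c * f x) :=
    (hf.continuous.measurable.const_mul _).ennreal_ofReal
  have h1 : MeasurePreserving e lam (lam.map e) := e.continuous.measurable.measurePreserving lam
  refine (h1.withDensity_comp hm).map_eq.trans ?_
  rw [hlam, ENNReal.smul_def, withDensity_smul_measure,
    ← withDensity_smul _ hf.continuous.measurable.ennreal_ofReal]
  congr 1
  ext x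
  simp [ENNReal.ofReal_mul]

theorem HasSmoothTransport.of_equiv [FiniteDimensional ℝ E] [FiniteDimensional ℝ E']
    {lam : Measure E} [lam.IsAddHaarMeasure] (h : HasSmoothTransport lam) (lam' : Measure E')
    [lam'.IsAddHaarMeasure] (e : E ≃L[ℝ] E') : HasSmoothTransport lam' := by
  intro f g hf hf0 hg hg0 hfp hgp
  obtain ⟨f₀, hf₀, hf₀0, hfe⟩ := exists_smoothlyEquivalent_withDensity lam lam' e hf hf0
  obtain ⟨g₀, hg₀, hg₀0, hge⟩ := exists_smoothlyEquivalent_withDensity lam lam' e hg hg0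
  exact hfe.symm.trans ((h f₀ g₀ hf₀ hf₀0 hg₀ hg₀0 hfe.symm.isProbabilityMeasure
    hge.symm.isProbabilityMeasure).trans hge)

theorem exists_smoothlyEquivalent_prod_of_dominated [FiniteDimensional ℝ E] (lam : Measure E)
    [lam.IsAddHaarMeasure] {g : E × ℝ → ℝ}
    (hg : ContDiff ℝ ∞ g) (hpos : ∀ y, 0 < g y)
    [hp : IsProbabilityMeasure ((lam.prod volume).withDensity fun y => ENNReal.ofReal (g y))]
    (hb : ∀ (k : ℕ) (R : ℝ), ∃ b : ℝ → ℝ, Integrable b ∧ ∀ t z, ‖z‖ ≤ R →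
      ‖iteratedFDeriv ℝ k (fun z => g (z, t)) z‖ ≤ b t) :
    ∃ F : E → ℝ, ContDiff ℝ ∞ F ∧ (∀ z, 0 < F z) ∧
      IsProbabilityMeasure (lam.withDensity fun z => ENNReal.ofReal (F z)) ∧
      SmoothlyEquivalent ((lam.prod volume).withDensity fun y => ENNReal.ofReal (g y))
        ((lam.withDensity fun z => ENNReal.ofReal (F z)).prod
          (volume.withDensity fun s => ENNReal.ofReal (logisticDensity s))) := by
  obtain ⟨F, hF, hF0, hFi, hFe⟩ := smoothlyEquivalent_prod_of_dominated lam hg hpos hb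
  refine ⟨F, hF, hF0, ⟨?_⟩, hFe⟩
  have h1 := hp.measure_univ
  rw [withDensity_apply _ MeasurableSet.univ, setLIntegral_univ,
    lintegral_prod _ hg.continuous.measurable.ennreal_ofReal.aemeasurable] at h1
  rw [withDensity_apply _ MeasurableSet.univ, setLIntegral_univ]
  simp only [hFi]
  exact h1

/-- A probability measure with a smooth positive density on a product with the line is smoothly
equivalent to a product. -/
theorem exists_smoothlyEquivalent_prod [FiniteDimensional ℝ E] (lam : Measure E)
    [lam.IsAddHaarMeasure] {f : E × ℝ → ℝ} (hf : ContDiff ℝ ∞ f) (hpos : ∀ y, 0 < f y)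
    (hp : IsProbabilityMeasure ((lam.prod volume).withDensity fun y => ENNReal.ofReal (f y))) :
    ∃ F : E → ℝ, ContDiff ℝ ∞ F ∧ (∀ z, 0 < F z) ∧
      IsProbabilityMeasure (lam.withDensity fun z => ENNReal.ofReal (F z)) ∧
      SmoothlyEquivalent ((lam.prod volume).withDensity fun y => ENNReal.ofReal (f y))
        ((lam.withDensity fun z => ENNReal.ofReal (F z)).prod
          (volume.withDensity fun s => ENNReal.ofReal (logisticDensity s))) := by
  by_cases hm : Module.finrank ℝ E = 0
  -- The shear has no effect when `E` is a point, but then the density itself is integrable in `t`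
  -- and depends on `t` only.
  · have hE : Subsingleton E := Module.finrank_zero_iff.1 hm
    have hfc : Continuous fun t => f (0, t) := hf.continuous.comp (by fun_prop)
    have hint : Integrable fun t => f (0, t) := by
      refine ⟨hfc.aestronglyMeasurable, ?_⟩
      rw [hasFiniteIntegral_iff_ofReal (.of_forall fun t => (hpos _).le)]
      have h1 := hp.measure_univ
      rw [withDensity_apply _ MeasurableSet.univ, setLIntegral_univ,
        lintegral_prod _ hf.continuous.measurable.ennreal_ofReal.aemeasurable] at h1
      have h2 := ae_lt_top (μ := lam) hf.continuous.measurable.ennreal_ofReal.lintegral_prod_right'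
        (h1 ▸ ENNReal.one_ne_top)
      obtain ⟨z, hz⟩ := h2.exists
      rwa [Subsingleton.elim z 0] at hz
    refine exists_smoothlyEquivalent_prod_of_dominated lam hf hpos fun k R =>
      ⟨_, hint, fun t z _ => ?_⟩
    have h3 : (fun z => f (z, t)) = fun _ => f (0, t) := by
      ext z; rw [Subsingleton.elim z 0]
    rw [h3]
    rcases eq_or_ne k 0 with rfl | hk
    · simp [abs_of_pos (hpos _)]
    · rw [iteratedFDeriv_const_of_ne hk]
      simpa using (hpos _).le
  · obtain ⟨a, ha, ha0, hb⟩ := exists_shear_dominated hf hm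
    have h1 := map_shearEquiv_withDensity lam ha0 ha hf.continuous.measurable
    have h2 : SmoothlyEquivalent ((lam.prod volume).withDensity fun y => ENNReal.ofReal (f y)) _ :=
      ⟨shearEquiv a ha0, contDiff_shearEquiv ha0 ha, contDiff_shearEquiv_symm ha0 ha, h1⟩
    have h3 := h2.isProbabilityMeasure
    have hg : ContDiff ℝ ∞ fun y : E × ℝ => a y.2 ^ Module.finrank ℝ E * f (a y.2 • y.1, y.2) :=
      ((ha.comp contDiff_snd).pow _).mul (hf.comp (contDiff_shearEquiv_symm ha0 ha))
    obtain ⟨F, hF, hF0, hFp, hFe⟩ := exists_smoothlyEquivalent_prod_of_dominated lam hg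
      (fun y => mul_pos (pow_pos (ha0 _) _) (hpos _)) hb
    exact ⟨F, hF, hF0, hFp, h2.trans hFe⟩

/-- Both measures are straightened to products with the same logistic factor, so only their first
factors remain to be matched. -/
theorem HasSmoothTransport.prod_volume [FiniteDimensional ℝ E] {lam : Measure E}
    [lam.IsAddHaarMeasure] (h : HasSmoothTransport lam) :
    HasSmoothTransport (lam.prod (volume : Measure ℝ)) := by
  intro f g hf hf0 hg hg0 hfp hgp
  obtain ⟨F, hF, hF0, hFp, hFe⟩ := exists_smoothlyEquivalent_prod lam hf hf0 hfp
  obtain ⟨G, hG, hG0, hGp, hGe⟩ := exists_smoothlyEquivalent_prod lam hg hg0 hgp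
  exact hFe.trans (((h F G hF hF0 hG hG0 hFp hGp).prod_right _).trans hGe.symm)

theorem hasSmoothTransport_addHaar (n : ℕ) : ∀ {E : Type} [NormedAddCommGroup E] [NormedSpace ℝ E]
    [FiniteDimensional ℝ E] [MeasurableSpace E] [BorelSpace E] (lam : Measure E)
    [lam.IsAddHaarMeasure], Module.finrank ℝ E = n → HasSmoothTransport lam := by
  induction n with
  | zero =>
    intro E _ _ _ _ _ lam _ hE
    have := Module.finrank_zero_iff.1 hE
    exact hasSmoothTransport_of_subsingleton lam
  | succ n ih =>
    intro E _ _ _ _ _ lam _ hE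
    have h1 : HasSmoothTransport (volume : Measure (Fin n → ℝ)) := ih _ (by simp)
    exact h1.prod_volume.of_equiv lam (ContinuousLinearEquiv.ofFinrankEq (by simp [hE]))

theorem contDiff_stdGaussianDensity (n : ℕ) : ContDiff ℝ ∞ (stdGaussianDensity n) := by
  unfold stdGaussianDensity
  exact (((contDiff_norm_sq ℝ).div_const _).neg.sub contDiff_const).exp

/-- A probability measure with a smooth positive density is transported to the standard Gaussian
measure by a smooth diffeomorphism. -/
theorem exists_map_symm_eq_stdGaussian {n : ℕ} {f : EuclideanSpace ℝ (Fin n) → ℝ}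
    (hf : ContDiff ℝ ∞ f) (hpos : ∀ x, 0 < f x)
    (hp : IsProbabilityMeasure (volume.withDensity fun x => ENNReal.ofReal (f x))) :
    ∃ T : SmoothDiffeo n, Measure.map T.symm (volume.withDensity fun x => ENNReal.ofReal (f x)) =
      stdGaussian (EuclideanSpace ℝ (Fin n)) := by
  have h := hasSmoothTransport_addHaar n (volume : Measure (EuclideanSpace ℝ (Fin n))) (by simp)
  have hg : IsProbabilityMeasure (volume.withDensity fun x : EuclideanSpace ℝ (Fin n) =>
      ENNReal.ofReal (stdGaussianDensity n x)) := by
    rw [← stdGaussian_eq_withDensity]; infer_instance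
  obtain ⟨T, hT, hT', hmap⟩ := h f (stdGaussianDensity n) hf hpos (contDiff_stdGaussianDensity n)
    (fun x => Real.exp_pos _) hp hg
  rw [← stdGaussian_eq_withDensity] at hmap
  -- The transport goes from `μ` to the Gaussian, so it must be the inverse of the diffeomorphism
  -- that is returned.
  exact ⟨⟨T.symm, hT'.contMDiff, hT.contMDiff⟩, hmap⟩

end SmoothTransport

/-! ### Assembly: lower bound, equality case and attained minimum. -/

theorem mainTheorem11 (n : ℕ) (μ : Measure (EuclideanSpace ℝ (Fin n))) [IsProbabilityMeasure μ]
    (f : EuclideanSpace ℝ (Fin n) → ℝ) (hf_nonneg : ∀ x, 0 ≤ f x) (hf_diff : Differentiable ℝ f)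
    (hμ : μ = volume.withDensity (fun x => ENNReal.ofReal (f x)))
    (hH : QuasiIntegrable (llr μ volume) μ) :
    (∀ T : SmoothDiffeo n,
      relEntropy μ volume - relEntropy (stdGaussian (EuclideanSpace ℝ (Fin n))) volume
        ≤ psiFunctional μ f T) ∧
    (∀ T : SmoothDiffeo n, Measure.map T.symm μ = stdGaussian (EuclideanSpace ℝ (Fin n)) →
      psiFunctional μ f T =
        relEntropy μ volume - relEntropy (stdGaussian (EuclideanSpace ℝ (Fin n))) volume) ∧
    (ContDiff ℝ ∞ f → (∀ x, 0 < f x) →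
      (∃ T : SmoothDiffeo n,
        Measure.map T.symm μ = stdGaussian (EuclideanSpace ℝ (Fin n))) ∧
      IsLeast (Set.range (fun T : SmoothDiffeo n => psiFunctional μ f T))
        (relEntropy μ volume -
          relEntropy (stdGaussian (EuclideanSpace ℝ (Fin n))) volume)) := by
  have h1 := fun T => relEntropy_sub_le_psiFunctional hf_nonneg hf_diff hμ T
  have h2 := fun T hT => psiFunctional_eq_of_map_eq_stdGaussian hf_nonneg hf_diff hμ hH T hT
  refine ⟨h1, h2, fun hf hpos => ?_⟩
  obtain ⟨T, hT⟩ : ∃ T : SmoothDiffeo n,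
      Measure.map T.symm μ = stdGaussian (EuclideanSpace ℝ (Fin n)) := by
    have hp : IsProbabilityMeasure μ := inferInstance
    rw [hμ] at hp ⊢
    exact exists_map_symm_eq_stdGaussian hf hpos hp
  refine ⟨⟨T, hT⟩, ⟨T, h2 T hT⟩, ?_⟩
  rintro _ ⟨S, rfl⟩
  exact h1 S
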